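/- Let $K=\mathbb{Q}(\sqrt m)\subset\mathbb{R}$, $m>1$ squarefree, be a real-quadratic number field with ring of integers $\mathcal{O}_K$, discriminant $d_K$ and fundamental unit $\varepsilon_0>1$; let $a\mapsto a'$ be the non-trivial automorphism of $K$. Let $\Gamma_K=SL_2(\mathcal{O}_K)$, let $$\mathcal{N}_K=\{M\in SL_2(\mathbb{R});\ M^{-1}\Gamma_K M=\Gamma_K\}$$ be its normalizer in $SL_2(\mathbb{R})$, and let $\Sigma_K$ be the group of all matrices $M=\frac{1}{\sqrt{\ell}}L\in SL_2(\mathbb{R})$ with $\ell$ a positive integer and $L\in\mathcal{O}_K^{2\times 2}$. It acts on $\mathcal{H}^2$, where $\mathcal{H}$ is the upper half-plane, by $(\tau_1,\tau_2)\mapsto(M\langle\tau_1\rangle,M'\langle\tau_2\rangle)$ with $M'=\frac{1}{\sqrt{\ell}}L'$ (well defined up to sign). Then among the subgroups of $\Sigma_K$ that contain $\Gamma_K$ and act discontinuously on $\mathcal{H}^2$ there is a largest one, the Hurwitz–Maaß extension $\Gamma^*_K$, and the following holds. (a) If $\varepsilon_0\varepsilon_0'=1$ and $p\mid d_K$ for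 some prime $p\equiv 3\bmod 4$, then $\mathcal{N}_K=\Gamma^*_K$. (b) In any other case $$\mathcal{N}_K=\Gamma^*_K\cup M_0\Gamma^*_K$$ with a matrix $M_0\in SL_2(\mathbb{R})$, $M_0\notin\Gamma^*_K$, which may be chosen as follows. If $\varepsilon_0\varepsilon_0'=-1$, one may take $$M_0=\frac{1}{\sqrt{\varepsilon_0}}\begin{pmatrix}\varepsilon_0&0\\0&1\end{pmatrix}.$$ Moreover, in every case under (b) there are positive integers $\alpha,\beta$ with $\alpha$ odd and $m=\alpha^2+\beta^2$, and integers $\nu,\mu$ with $\nu\alpha-2\mu\beta=1$; for any such choice one may take, with $u=\beta+\sqrt m$, $$M_0=\frac{1}{\sqrt{u}}\begin{pmatrix}\mu\alpha+\nu u&\mu u\\u&\alpha\end{pmatrix}.$$ -/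

import Mathlib

open scoped MatrixGroups Pointwise UpperHalfPlane
open NumberField

noncomputable section

namespace HilbertModular

variable {K : Type*} [Field K]

/-- The real matrix obtained from an integral matrix `L` over `K` by applying a real embedding
`σ` to its entries. -/
def embedMatrix (σ : K →+* ℝ) (L : Matrix (Fin 2) (Fin 2) (𝓞 K)) : Matrix (Fin 2) (Fin 2) ℝ :=
  L.map fun x => σ (x : K)

/-- The Hilbert modular group `SL₂(𝓞 K)`, as a subgroup of `SL₂(ℝ)` by means of the real
embedding `σ`. -/
def hilbertModularGroup (σ : K →+* ℝ) : Subgroup SL(2, ℝ) :=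
  (Matrix.SpecialLinearGroup.map (n := Fin 2) (σ.comp (algebraMap (𝓞 K) K))).range

/-- The matrices `M = L / √ℓ` and `M' = L' / √ℓ` of `SL₂(ℝ)` are conjugate, where `ℓ` is a positive
integer, `L` is an integral matrix over `K`, and `L`, `L'` are its images under the two real
embeddings `σ`, `σ'`. For a given `M` the matrix `M'` is unique up to its sign, so that its action
on the upper half-plane depends on `M` only. -/
def AreConjugate (σ σ' : K →+* ℝ) (M M' : SL(2, ℝ)) : Prop :=
  ∃ (ℓ : ℕ) (L : Matrix (Fin 2) (Fin 2) (𝓞 K)), 0 < ℓ ∧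
    (M : Matrix (Fin 2) (Fin 2) ℝ) = (√(ℓ : ℝ))⁻¹ • embedMatrix σ L ∧
    (M' : Matrix (Fin 2) (Fin 2) ℝ) = (√(ℓ : ℝ))⁻¹ • embedMatrix σ' L

/-- The set `Σ_K` of all matrices of `SL₂(ℝ)` of the form `L / √ℓ`, with `ℓ` a positive integer and
`L` an integral matrix over `K`. -/
def sigmaSet (σ : K →+* ℝ) : Set SL(2, ℝ) :=
  {M | ∃ (ℓ : ℕ) (L : Matrix (Fin 2) (Fin 2) (𝓞 K)), 0 < ℓ ∧
    (M : Matrix (Fin 2) (Fin 2) ℝ) = (√(ℓ : ℝ))⁻¹ • embedMatrix σ L}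

/-- A subgroup `Γ` of `SL₂(ℝ)` contained in `Σ_K` acts discontinuously on `ℍ × ℍ` through
`(τ₁, τ₂) ↦ (M τ₁, M' τ₂)`: for every compact `C` only finitely many `M ∈ Γ` move some point of
`C` into `C`. -/
def ActsDiscontinuously (σ σ' : K →+* ℝ) (Γ : Subgroup SL(2, ℝ)) : Prop :=
  ∀ C : Set (ℍ × ℍ), IsCompact C →
    {M : SL(2, ℝ) | M ∈ Γ ∧ ∃ M' : SL(2, ℝ), AreConjugate σ σ' M M' ∧
      ∃ τ ∈ C, (M • τ.1, M' • τ.2) ∈ C}.Finite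

/-- The discontinuous extensions of the Hilbert modular group: the subgroups of `SL₂(ℝ)` that
contain it, lie in `Σ_K` and act discontinuously on `ℍ × ℍ`. -/
def discontinuousExtensions (σ σ' : K →+* ℝ) : Set (Subgroup SL(2, ℝ)) :=
  {Γ | hilbertModularGroup σ ≤ Γ ∧ (Γ : Set SL(2, ℝ)) ⊆ sigmaSet σ ∧ ActsDiscontinuously σ σ' Γ}

/-- The Hurwitz–Maaß extension: the maximal discontinuous extension of the Hilbert modular group,
written as the supremum of all of them. -/
def hurwitzMaassExtension (σ σ' : K →+* ℝ) : Subgroup SL(2, ℝ) :=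
  sSup (discontinuousExtensions σ σ')

/-- The normalizer of the Hilbert modular group in `SL₂(ℝ)`. -/
def normalizerGroup (σ : K →+* ℝ) : Set SL(2, ℝ) :=
  {M | MulAut.conj M⁻¹ • hilbertModularGroup σ = hilbertModularGroup σ}

/-- `ε` is the fundamental unit of `K` with respect to the real embedding `σ`: it is greater
than `1` and generates the units modulo `±1`. -/
def IsFundamentalUnit (σ : K →+* ℝ) (ε : (𝓞 K)ˣ) : Prop :=
  1 < σ (ε : 𝓞 K) ∧ ∀ η : (𝓞 K)ˣ, ∃ n : ℤ, η = ε ^ n ∨ η = -ε ^ n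

/-- `m = α² + β²` with positive integers `α`, `β` and `α` odd, and `ν α - 2 μ β = 1`. -/
def IsAdmissible (m α β : ℕ) (ν μ : ℤ) : Prop :=
  0 < α ∧ 0 < β ∧ Odd α ∧ m = α ^ 2 + β ^ 2 ∧ ν * α - 2 * μ * β = 1

/-- The matrix `L` with rows `(μ α + ν u, μ u)` and `(u, α)`. -/
def matrixL (α : ℕ) (ν μ : ℤ) (u : ℝ) : Matrix (Fin 2) (Fin 2) ℝ :=
  !![μ * α + ν * u, μ * u; u, α]

/-- The normalizer is the union of the Hurwitz–Maaß extension and its coset by the matrix `A`,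
which has determinant `1` and lies outside the Hurwitz–Maaß extension. -/
def NormalizerIsUnionWith (σ σ' : K →+* ℝ) (A : Matrix (Fin 2) (Fin 2) ℝ) : Prop :=
  ∃ M₀ : SL(2, ℝ), (M₀ : Matrix (Fin 2) (Fin 2) ℝ) = A ∧
    M₀ ∉ hurwitzMaassExtension σ σ' ∧
    normalizerGroup σ = (hurwitzMaassExtension σ σ' : Set SL(2, ℝ)) ∪
      M₀ • (hurwitzMaassExtension σ σ' : Set SL(2, ℝ))

end HilbertModular

end

/-! A matrix M of determinant one normalizes Γ_K exactly when all products of two of its entries lie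
in 𝓞_K (`mem_normalizerGroup_iff`). Such an M is √δ·P with P over K, and δ is unique up to squares.
If I is the fractional ideal generated by the entries of P, then δI² = 1, so the norm of δ is ±r²
with r rational (`HasIntegralProducts.norm_eq_or`). The sign is the whole invariant: for norm r² the
class of δ is rational and M lies in Σ_K, while membership in Σ_K forces σ'(δ) > 0. Hence N_K ∩ Σ_K
has index at most 2 in N_K.

This intersection is Γ*_K (`isGreatest_normalizerInter`). It acts discontinuously because the
squares of its entries are algebraic integers with both conjugates bounded. Conversely, let Γ be a
discontinuous extension. Its translations over K form a lattice, and a group between SL₂(𝓞_K) and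
SL₂(K) with this property is SL₂(𝓞_K) (`eq_integralSL`). Since Γ lies in Σ_K, conjugates of Γ_K by
elements of Γ have entries in K, so they stay in Γ_K.

It remains to decide whether norm -r² occurs. It would give a² + r² = m b² over ℚ, impossible if a
prime p ≡ 3 mod 4 divides m. Without such primes m is a sum of two squares, and the explicit matrix
with u = β + √m has the negative sign. A unit of norm -1 itself rules out these primes and gives the
diagonal matrix. -/

noncomputable section

namespace HilbertModular

/-! ### Arithmetic of a real-quadratic field through its two embeddings -/

section Quadratic

variable {K : Type*} [Field K] [NumberField K]

/-- The complex embeddings of a quadratic field with two real embeddings `σ ≠ σ'`. -/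
theorem eq_or_eq_of_complex_embedding (hK : Module.finrank ℚ K = 2) {σ σ' : K →+* ℝ}
    (hσ : σ ≠ σ') (φ : K →+* ℂ) :
    φ = Complex.ofRealHom.comp σ ∨ φ = Complex.ofRealHom.comp σ' := by
  classical
  have hne : Complex.ofRealHom.comp σ ≠ Complex.ofRealHom.comp σ' := by
    intro h
    apply hσ
    ext x
    have := RingHom.congr_fun h x
    simpa using this
  have hcard : ({Complex.ofRealHom.comp σ, Complex.ofRealHom.comp σ'} :
      Finset (K →+* ℂ)).card = Fintype.card (K →+* ℂ) := by
    rw [NumberField.Embeddings.card, hK, Finset.card_pair hne]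
  have := Finset.eq_univ_of_card _ hcard
  have h2 := Finset.mem_univ φ
  rw [← this] at h2
  simpa using h2

theorem exists_pair_eq_univ_embeddings (hK : Module.finrank ℚ K = 2) {σ σ' : K →+* ℝ}
    (hσ : σ ≠ σ') [DecidableEq (K →ₐ[ℚ] ℂ)] :
    (Complex.ofRealHom.comp σ).toRatAlgHom ≠ (Complex.ofRealHom.comp σ').toRatAlgHom ∧
    (Finset.univ : Finset (K →ₐ[ℚ] ℂ)) =
      {(Complex.ofRealHom.comp σ).toRatAlgHom, (Complex.ofRealHom.comp σ').toRatAlgHom} := by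
  have hne : (Complex.ofRealHom.comp σ).toRatAlgHom ≠ (Complex.ofRealHom.comp σ').toRatAlgHom := by
    intro h
    apply hσ
    ext x
    have := AlgHom.congr_fun h x
    simpa using this
  refine ⟨hne, ?_⟩
  symm
  apply Finset.eq_univ_of_card
  rw [Finset.card_pair hne, AlgHom.card, hK]

theorem norm_eq_mul_embeddings (hK : Module.finrank ℚ K = 2) {σ σ' : K →+* ℝ}
    (hσ : σ ≠ σ') (x : K) : ((Algebra.norm ℚ x : ℚ) : ℝ) = σ x * σ' x := by
  classical
  obtain ⟨hne, huniv⟩ := exists_pair_eq_univ_embeddings hK hσ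
  have h := Algebra.norm_eq_prod_embeddings ℚ ℂ x
  rw [huniv, Finset.prod_pair hne] at h
  have h2 : (((Algebra.norm ℚ x : ℚ) : ℝ) : ℂ) = ((σ x * σ' x : ℝ) : ℂ) := by
    simpa using h
  exact_mod_cast h2

theorem trace_eq_add_embeddings (hK : Module.finrank ℚ K = 2) {σ σ' : K →+* ℝ}
    (hσ : σ ≠ σ') (x : K) : ((Algebra.trace ℚ K x : ℚ) : ℝ) = σ x + σ' x := by
  classical
  obtain ⟨hne, huniv⟩ := exists_pair_eq_univ_embeddings hK hσ
  have h := trace_eq_sum_embeddings ℂ (K := ℚ) (x := x)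
  rw [huniv, Finset.sum_pair hne] at h
  have h2 : (((Algebra.trace ℚ K x : ℚ) : ℝ) : ℂ) = ((σ x + σ' x : ℝ) : ℂ) := by
    simpa using h
  exact_mod_cast h2

theorem not_isSquare_cast_of_squarefree {m : ℕ} (hm1 : 1 < m) (hm : Squarefree m) :
    ¬ IsSquare (m : ℚ) := by
  rw [Rat.isSquare_natCast_iff]
  rintro ⟨r, rfl⟩
  have := hm r dvd_rfl
  simp only [Nat.isUnit_iff] at this
  subst this
  simp at hm1

theorem exists_basis_one_sqrt (hK : Module.finrank ℚ K = 2) {m : ℕ} (hm1 : 1 < m)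
    (hm : Squarefree m) {s : K} (hs : s ^ 2 = (m : K)) :
    ∃ b : Module.Basis (Fin 2) ℚ K, ⇑b = ![1, s] := by
  have hli : LinearIndependent ℚ ![(1 : K), s] := by
    rw [LinearIndependent.pair_iff' one_ne_zero]
    intro a ha
    apply not_isSquare_cast_of_squarefree hm1 hm
    refine ⟨a, ?_⟩
    have h2 : ((a * a : ℚ) : K) = ((m : ℚ) : K) := by
      rw [Algebra.smul_def, mul_one] at ha
      simp only [Rat.cast_mul, Rat.cast_natCast]
      rw [← hs, ← ha, sq]
      simp
    exact (Rat.cast_injective h2).symm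
  exact ⟨basisOfLinearIndependentOfCardEqFinrank hli (by simp [hK]), by simp⟩

theorem exists_eq_rat_add_rat_mul (hK : Module.finrank ℚ K = 2) {m : ℕ} (hm1 : 1 < m)
    (hm : Squarefree m) {s : K} (hs : s ^ 2 = (m : K)) (x : K) :
    ∃ a b : ℚ, x = a + b * s := by
  obtain ⟨b, hb⟩ := exists_basis_one_sqrt hK hm1 hm hs
  refine ⟨b.repr x 0, b.repr x 1, ?_⟩
  have := b.sum_repr x
  rw [Fin.sum_univ_two, hb] at this
  simpa [Algebra.smul_def] using this.symm

theorem embedding_sqrt_eq_neg (hK : Module.finrank ℚ K = 2) {σ σ' : K →+* ℝ}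
    (hσ : σ ≠ σ') {m : ℕ} (hm1 : 1 < m)
    (hm : Squarefree m) {s : K} (hs : s ^ 2 = (m : K)) : σ' s = - σ s := by
  have h1 : σ s ^ 2 = σ' s ^ 2 := by
    rw [← map_pow, ← map_pow, hs]; simp
  rcases sq_eq_sq_iff_eq_or_eq_neg.1 h1 with h | h
  · exfalso
    apply hσ
    ext x
    obtain ⟨a, b, rfl⟩ := exists_eq_rat_add_rat_mul hK hm1 hm hs x
    simp [h]
  · rw [h, neg_neg]

/-- Rounding down the coordinates with respect to 1, s leaves fractional parts in [0, 1). The bound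
is uniform in x, which makes 𝓞_K cobounded in K. -/
theorem exists_integer_near (hK : Module.finrank ℚ K = 2) {σ σ' : K →+* ℝ}
    (hσ : σ ≠ σ') {m : ℕ} (hm1 : 1 < m)
    (hm : Squarefree m) {s : K} (hs : s ^ 2 = (m : K)) (x : K) :
    ∃ y : 𝓞 K, |σ (x - y)| ≤ 1 + |σ s| ∧ |σ' (x - y)| ≤ 1 + |σ s| := by
  obtain ⟨a, b, rfl⟩ := exists_eq_rat_add_rat_mul hK hm1 hm hs x
  have hsi : IsIntegral ℤ s := by
    apply IsIntegral.of_pow (n := 2) (by norm_num)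
    rw [hs]
    exact_mod_cast isIntegral_algebraMap (R := ℤ) (A := K) (x := (m : ℤ))
  let t : 𝓞 K := ⟨s, hsi⟩
  have ht : (t : K) = s := rfl
  refine ⟨(⌊a⌋ : 𝓞 K) + (⌊b⌋ : 𝓞 K) * t, ?_⟩
  have he : ((a : K) + b * s) - (((⌊a⌋ : 𝓞 K) + (⌊b⌋ : 𝓞 K) * t : 𝓞 K) : K) =
      ((Int.fract a : ℚ) : K) + ((Int.fract b : ℚ) : K) * s := by
    have h1 : ((⌊a⌋ : ℤ) : K) = ((⌊a⌋ : ℚ) : K) := by simp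
    simp only [map_add, map_mul, map_intCast, ht, Int.fract, Rat.cast_sub, Rat.cast_intCast]
    ring
  have key : ∀ τ : ℝ, |τ| = |σ s| →
      |((Int.fract a : ℚ) : ℝ) + ((Int.fract b : ℚ) : ℝ) * τ| ≤ 1 + |σ s| := by
    intro τ hτ
    have ha0 : (0 : ℝ) ≤ ((Int.fract a : ℚ) : ℝ) := by exact_mod_cast Int.fract_nonneg a
    have hb0 : (0 : ℝ) ≤ ((Int.fract b : ℚ) : ℝ) := by exact_mod_cast Int.fract_nonneg b
    have ha1 : ((Int.fract a : ℚ) : ℝ) ≤ 1 := by exact_mod_cast (Int.fract_lt_one a).le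
    have hb1 : ((Int.fract b : ℚ) : ℝ) ≤ 1 := by exact_mod_cast (Int.fract_lt_one b).le
    refine (abs_add_le _ _).trans ?_
    rw [abs_mul, hτ, abs_of_nonneg ha0, abs_of_nonneg hb0]
    gcongr
    exact mul_le_of_le_one_left (abs_nonneg _) hb1
  rw [he]
  constructor
  · simpa using key (σ s) rfl
  · simpa using key (σ' s) (by rw [embedding_sqrt_eq_neg hK hσ hm1 hm hs, abs_neg])

theorem finite_integers_bounded (hK : Module.finrank ℚ K = 2) {σ σ' : K →+* ℝ}
    (hσ : σ ≠ σ') (B : ℝ) : {x : 𝓞 K | |σ x| ≤ B ∧ |σ' x| ≤ B}.Finite := by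
  refine Set.Finite.preimage (f := ((↑) : 𝓞 K → K)) (RingOfIntegers.coe_injective.injOn)
    (s := {x : K | |σ x| ≤ B ∧ |σ' x| ≤ B ∧ IsIntegral ℤ x}) ?_ |>.subset ?_
  · refine (Embeddings.finite_of_norm_le K ℂ B).subset ?_
    rintro x ⟨h1, h2, h3⟩
    refine ⟨h3, fun φ => ?_⟩
    rcases eq_or_eq_of_complex_embedding hK hσ φ with rfl | rfl <;> simpa
  · rintro x ⟨h1, h2⟩
    exact ⟨h1, h2, x.2⟩

/-- If an element of `ℚ(√m)` has norm `-r²`, then no prime `q ≡ 3 mod 4` divides `m`. -/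
theorem not_dvd_of_norm_eq_neg_sq (hK : Module.finrank ℚ K = 2) {σ σ' : K →+* ℝ}
    (hσ : σ ≠ σ') {m : ℕ} (hm1 : 1 < m)
    (hm : Squarefree m) {s : K} (hs : s ^ 2 = (m : K)) {x : K} {r : ℚ} (hr : r ≠ 0)
    (hx : σ x * σ' x = -(r : ℝ) ^ 2) {q : ℕ} (hq : q.Prime) (hq3 : q % 4 = 3) : ¬ q ∣ m := by
  intro hqm
  obtain ⟨a, b, rfl⟩ := exists_eq_rat_add_rat_mul hK hm1 hm hs x
  have hss : σ s * σ s = m := by rw [← sq, ← map_pow, hs]; simp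
  simp only [map_add, map_mul, map_ratCast, embedding_sqrt_eq_neg hK hσ hm1 hm hs] at hx
  have h1 : (a : ℝ) ^ 2 + (r : ℝ) ^ 2 = m * (b : ℝ) ^ 2 := by
    rw [← hss]; linear_combination hx
  have h2 : a ^ 2 + r ^ 2 = m * b ^ 2 := by exact_mod_cast h1
  have hb : b ≠ 0 := by
    rintro rfl
    have : 0 < r ^ 2 := by positivity
    nlinarith [sq_nonneg a]
  have had : (a.den : ℚ) ≠ 0 := by simp
  have hbd : (b.den : ℚ) ≠ 0 := by simp
  have hrd : (r.den : ℚ) ≠ 0 := by simp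
  have h3 : ((a.num * b.den * r.den) ^ 2 + (r.num * a.den * b.den) ^ 2 : ℤ) =
      m * (b.num * a.den * r.den) ^ 2 := by
    have h4 : ((a.num / a.den : ℚ)) ^ 2 + (r.num / r.den : ℚ) ^ 2 =
        m * (b.num / b.den : ℚ) ^ 2 := by
      rw [Rat.num_div_den, Rat.num_div_den, Rat.num_div_den]; exact h2
    field_simp at h4
    have h5 : (((a.num * b.den * r.den) ^ 2 + (r.num * a.den * b.den) ^ 2 : ℤ) : ℚ) =
      ((m * (b.num * a.den * r.den) ^ 2 : ℤ) : ℚ) := by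
      push_cast
      linear_combination h4
    exact_mod_cast h5
  set X := a.num * b.den * r.den
  set Y := r.num * a.den * b.den
  set Z := b.num * a.den * r.den with hZ
  have hZ0 : Z.natAbs ≠ 0 := by
    rw [hZ]; simp [hb]
  have h6 : m * Z.natAbs ^ 2 = X.natAbs ^ 2 + Y.natAbs ^ 2 := by
    zify
    simp only [sq_abs]
    exact h3.symm
  -- A prime q ≡ 3 mod 4 has even valuation in a sum of two squares, but odd valuation in m Z²
  -- because it divides the squarefree m once.
  have h7 := Nat.eq_sq_add_sq_iff.1 ⟨_, _, h6⟩ q (by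
    rw [Nat.mem_primeFactors]
    refine ⟨hq, hqm.mul_right _, ?_⟩
    positivity) hq3
  have : Fact q.Prime := ⟨hq⟩
  have hm0 : m ≠ 0 := by omega
  rw [padicValNat.mul hm0 (pow_ne_zero 2 hZ0), padicValNat.pow] at h7
  have h8 : padicValNat q m = 1 := by
    apply le_antisymm
    · rw [← Nat.factorization_def _ hq]
      exact hm.natFactorization_le_one q
    · exact one_le_padicValNat_of_dvd hm0 hqm
  rw [h8] at h7
  rw [Nat.even_iff] at h7
  omega

/-- The family 1, s has discriminant 4m, and k is the determinant of its coordinates in an integral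
basis. For odd primes this suffices, without distinguishing m mod 4. -/
theorem exists_four_mul_eq_sq_mul_discr (hK : Module.finrank ℚ K = 2) {σ σ' : K →+* ℝ}
    (hσ : σ ≠ σ') {m : ℕ} (hm1 : 1 < m)
    (hm : Squarefree m) {s : K} (hs : s ^ 2 = (m : K)) :
    ∃ k : ℤ, (4 * m : ℤ) = k ^ 2 * discr K := by
  classical
  have hsi : IsIntegral ℤ s := by
    apply IsIntegral.of_pow (n := 2) (by norm_num)
    rw [hs]
    exact_mod_cast isIntegral_algebraMap (R := ℤ) (A := K) (x := (m : ℤ))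
  let t : 𝓞 K := ⟨s, hsi⟩
  have ht : (t : K) = s := rfl
  have hcard : Fintype.card (Module.Free.ChooseBasisIndex ℤ (𝓞 K)) = 2 := by
    rw [← Module.finrank_eq_card_chooseBasisIndex, RingOfIntegers.rank, hK]
  let b := (RingOfIntegers.basis K).reindex (Fintype.equivFinOfCardEq hcard)
  have h1 := Algebra.discr_of_matrix_vecMul (A := ℤ) (⇑b) (b.toMatrix ![1, t])
  rw [Module.Basis.toMatrix_map_vecMul, discr_eq_discr] at h1
  refine ⟨_, Eq.trans ?_ h1⟩
  have tr : ∀ (x : 𝓞 K) (n : ℤ), σ x + σ' x = n → Algebra.trace ℤ (𝓞 K) x = n := by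
    intro x n h
    have h2 : ((Algebra.trace ℤ (𝓞 K) x : ℤ) : ℚ) = n := by
      rw [Algebra.coe_trace_int]
      have := trace_eq_add_embeddings hK hσ (x : K)
      rw [h] at this
      exact_mod_cast this
    exact_mod_cast h2
  have hss : σ s * σ s = m := by rw [← sq, ← map_pow, hs]; simp
  have hs' := embedding_sqrt_eq_neg hK hσ hm1 hm hs
  have t1 : Algebra.trace ℤ (𝓞 K) 1 = 2 := tr 1 2 (by norm_num)
  have t2 : Algebra.trace ℤ (𝓞 K) t = 0 := tr t 0 (by simp [ht, hs'])
  have t3 : Algebra.trace ℤ (𝓞 K) (t * t) = 2 * m :=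
    tr (t * t) (2 * m) (by simp [ht, hs', hss]; ring)
  rw [Algebra.discr_def, Matrix.det_fin_two]
  simp [Algebra.traceMatrix_apply, Algebra.traceForm_apply, t1, t2, t3]
  ring

theorem dvd_discr_iff (hK : Module.finrank ℚ K = 2) {σ σ' : K →+* ℝ}
    (hσ : σ ≠ σ') {m : ℕ} (hm1 : 1 < m)
    (hm : Squarefree m) {s : K} (hs : s ^ 2 = (m : K)) {q : ℕ} (hq : q.Prime) (hq2 : q ≠ 2) :
    (q : ℤ) ∣ discr K ↔ q ∣ m := by
  obtain ⟨k, hk⟩ := exists_four_mul_eq_sq_mul_discr hK hσ hm1 hm hs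
  have hqi : Prime (q : ℤ) := Nat.prime_iff_prime_int.1 hq
  have h4 : ¬ (q : ℤ) ∣ 4 := by
    intro h
    have h' : q ∣ 2 ^ 2 := by exact_mod_cast h
    exact hq2 ((Nat.prime_dvd_prime_iff_eq hq Nat.prime_two).1 (hq.dvd_of_dvd_pow h'))
  constructor
  · intro h
    have : (q : ℤ) ∣ 4 * m := hk ▸ h.mul_left _
    exact_mod_cast (hqi.dvd_or_dvd this).resolve_left h4
  · intro h
    by_contra hd
    have h1 : (q : ℤ) ∣ k ^ 2 * discr K := by
      rw [← hk]; exact (Int.natCast_dvd_natCast.2 h).mul_left _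
    have h2 : (q : ℤ) ∣ k := hqi.dvd_of_dvd_pow ((hqi.dvd_or_dvd h1).resolve_right hd)
    have h3 : (q : ℤ) * q ∣ 4 * m := by
      rw [hk, sq]
      exact (mul_dvd_mul h2 h2).mul_right _
    have h5 : q * q ∣ 4 * m := by exact_mod_cast h3
    have h6 : Nat.Coprime (q * q) 4 := by
      have : Nat.Coprime q 2 := (Nat.coprime_primes hq Nat.prime_two).2 hq2
      exact (Nat.Coprime.mul_left this this).pow_right 2
    have h7 := hm q (h6.dvd_of_dvd_mul_left h5)
    exact hq.one_lt.ne' (Nat.isUnit_iff.1 h7)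

end Quadratic

/-! ### The normalizer through products of entries -/

section Normalizer

variable {K : Type*} [Field K]

/-- The ring of integers of `K` as a subring of `ℝ`. -/
def integerRing (σ : K →+* ℝ) : Subring ℝ := (σ.comp (algebraMap (𝓞 K) K)).range

theorem mem_integerRing {σ : K →+* ℝ} {x : ℝ} :
    x ∈ integerRing σ ↔ ∃ y : 𝓞 K, σ y = x := Iff.rfl

theorem sl_mul_apply {R : Type*} [CommRing R] (A B : SL(2, R)) (i j : Fin 2) :
    (A * B) i j = A i 0 * B 0 j + A i 1 * B 1 j := by
  rw [Matrix.SpecialLinearGroup.coe_mul, Matrix.mul_apply, Fin.sum_univ_two]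

theorem sl_inv_apply {R : Type*} [CommRing R] (A : SL(2, R)) :
    A⁻¹ 0 0 = A 1 1 ∧ A⁻¹ 0 1 = -A 0 1 ∧ A⁻¹ 1 0 = -A 1 0 ∧ A⁻¹ 1 1 = A 0 0 := by
  simp [Matrix.SpecialLinearGroup.coe_inv, Matrix.adjugate_fin_two]

theorem sl_det {R : Type*} [CommRing R] (A : SL(2, R)) :
    A 0 0 * A 1 1 - A 0 1 * A 1 0 = 1 := by
  have := A.det_coe
  rwa [Matrix.det_fin_two] at this

/-- A matrix of determinant one with entries in the range of an injective ring homomorphism comes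
from a matrix of determinant one. -/
theorem mem_range_map_of_forall_mem {R S : Type*} [CommRing R] [CommRing S] {f : R →+* S}
    (hf : Function.Injective f) {M : SL(2, S)} (h : ∀ i j, M i j ∈ f.range) :
    M ∈ (Matrix.SpecialLinearGroup.map (n := Fin 2) f).range := by
  choose L hL using h
  refine ⟨⟨Matrix.of L, ?_⟩, ?_⟩
  · apply hf
    have := M.det_coe
    rw [Matrix.det_fin_two] at this ⊢
    simp only [Matrix.of_apply, map_sub, map_mul, hL, map_one]
    exact this
  · ext i j
    exact hL i j

theorem mem_hilbertModularGroup {σ : K →+* ℝ} {M : SL(2, ℝ)} :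
    M ∈ hilbertModularGroup σ ↔ ∀ i j, M i j ∈ integerRing σ := by
  constructor
  · rintro ⟨L, rfl⟩ i j
    exact ⟨L i j, by simp⟩
  · intro h
    exact mem_range_map_of_forall_mem (f := σ.comp (algebraMap (𝓞 K) K))
      (σ.injective.comp RingOfIntegers.coe_injective) h

theorem normalizerGroup_eq (σ : K →+* ℝ) :
    normalizerGroup σ = (Subgroup.normalizer (hilbertModularGroup σ : Set SL(2, ℝ)) :
      Set SL(2, ℝ)) := by
  ext M
  rw [SetLike.mem_coe, Subgroup.mem_normalizer_iff]
  simp only [normalizerGroup, Set.mem_ofPred_eq]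
  rw [SetLike.ext_iff]
  refine forall_congr' fun h => ?_
  rw [Subgroup.mem_pointwise_smul_iff_inv_smul_mem]
  simp only [map_inv, inv_inv, MulAut.smul_def, MulAut.conj_apply]
  exact iff_comm

/-- All products of two entries of `M` lie in the ring of integers. -/
def HasIntegralProducts (σ : K →+* ℝ) (M : SL(2, ℝ)) : Prop :=
  ∀ i j k l, M i j * M k l ∈ integerRing σ

theorem HasIntegralProducts.inv {σ : K →+* ℝ} {M : SL(2, ℝ)} (hM : HasIntegralProducts σ M) :
    HasIntegralProducts σ M⁻¹ := by
  intro i j k l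
  have key : ∀ i j, ∃ k l, M⁻¹ i j = M k l ∨ M⁻¹ i j = - M k l := by
    obtain ⟨h1, h2, h3, h4⟩ := sl_inv_apply M
    intro i j
    fin_cases i <;> fin_cases j
    · exact ⟨_, _, Or.inl h1⟩
    · exact ⟨_, _, Or.inr h2⟩
    · exact ⟨_, _, Or.inr h3⟩
    · exact ⟨_, _, Or.inl h4⟩
  obtain ⟨a, b, h⟩ := key i j
  obtain ⟨c, d, h'⟩ := key k l
  rcases h with h | h <;> rcases h' with h' | h' <;> rw [h, h']
  · exact hM _ _ _ _
  · rw [mul_neg]; exact neg_mem (hM _ _ _ _)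
  · rw [neg_mul]; exact neg_mem (hM _ _ _ _)
  · rw [neg_mul_neg]; exact hM _ _ _ _

theorem HasIntegralProducts.conj_mem {σ : K →+* ℝ} {M : SL(2, ℝ)}
    (hM : HasIntegralProducts σ M) {h : SL(2, ℝ)} (hh : h ∈ hilbertModularGroup σ) :
    M * h * M⁻¹ ∈ hilbertModularGroup σ := by
  rw [mem_hilbertModularGroup] at hh ⊢
  intro i j
  have key : ∀ a b c d e f : Fin 2, M a b * h c d * M e f ∈ integerRing σ := by
    intro a b c d e f
    rw [mul_right_comm]
    exact mul_mem (hM _ _ _ _) (hh _ _)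
  obtain ⟨h1, h2, h3, h4⟩ := sl_inv_apply M
  rw [sl_mul_apply, sl_mul_apply, sl_mul_apply]
  fin_cases j
  · simp only [Fin.zero_eta, h1, h3, add_mul, mul_neg, neg_add]
    exact add_mem (add_mem (key _ _ _ _ _ _) (key _ _ _ _ _ _))
      (add_mem (neg_mem (key _ _ _ _ _ _)) (neg_mem (key _ _ _ _ _ _)))
  · simp only [Fin.mk_one, h2, h4, add_mul, mul_neg, neg_add]
    exact add_mem (add_mem (neg_mem (key _ _ _ _ _ _)) (neg_mem (key _ _ _ _ _ _)))
      (add_mem (key _ _ _ _ _ _) (key _ _ _ _ _ _))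

/-- Conjugating the two elementary unipotent matrices shows that the products within each column are
integral; the determinant supplies the rest. Conversely, entries of M h M⁻¹ are sums of integral
multiples of products of two entries of M. -/
theorem mem_normalizerGroup_iff {σ : K →+* ℝ} {M : SL(2, ℝ)} :
    M ∈ normalizerGroup σ ↔ HasIntegralProducts σ M := by
  rw [normalizerGroup_eq, SetLike.mem_coe, Subgroup.mem_normalizer_iff]
  constructor
  · intro H
    have hdet : M 0 0 * M 1 1 - M 0 1 * M 1 0 = 1 := by
      exact sl_det M
    let T : SL(2, ℝ) := ⟨!![1, 1; 0, 1], by simp⟩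
    let T' : SL(2, ℝ) := ⟨!![1, 0; 1, 1], by simp⟩
    have hT : T ∈ hilbertModularGroup σ := by
      rw [mem_hilbertModularGroup]
      intro i j
      fin_cases i <;> fin_cases j <;> simp [T, zero_mem, one_mem]
    have hT' : T' ∈ hilbertModularGroup σ := by
      rw [mem_hilbertModularGroup]
      intro i j
      fin_cases i <;> fin_cases j <;> simp [T', zero_mem, one_mem]
    have h1 := mem_hilbertModularGroup.1 ((H T).1 hT)
    have h2 := mem_hilbertModularGroup.1 ((H T').1 hT')
    have o := one_mem (integerRing σ)
    have e1 := h1 0 0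
    have e2 := h1 0 1
    have e3 := h1 1 0
    have f1 := h2 0 0
    have f2 := h2 0 1
    have f3 := h2 1 0
    have t1 : T 0 0 = 1 ∧ T 0 1 = 1 ∧ T 1 0 = 0 ∧ T 1 1 = 1 := by simp [T]
    have t2 : T' 0 0 = 1 ∧ T' 0 1 = 0 ∧ T' 1 0 = 1 ∧ T' 1 1 = 1 := by simp [T']
    simp only [sl_mul_apply, sl_inv_apply M, t1, t2, mul_one, mul_zero, add_zero, zero_add]
      at e1 e2 e3 f1 f2 f3
    set a := M 0 0
    set b := M 0 1
    set c := M 1 0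
    set d := M 1 1
    have aa : a * a ∈ integerRing σ := by convert e2 using 1; ring
    have cc : c * c ∈ integerRing σ := by convert neg_mem e3 using 1; ring
    have ac : a * c ∈ integerRing σ := by
      convert sub_mem o e1 using 1; linear_combination hdet
    have bb : b * b ∈ integerRing σ := by convert neg_mem f2 using 1; ring
    have dd : d * d ∈ integerRing σ := by convert f3 using 1; ring
    have bd : b * d ∈ integerRing σ := by
      convert sub_mem f1 o using 1; linear_combination -hdet
    -- Multiplying ad by 1 = ad - bc rewrites it in products already known to be integral; ab and cd
    -- below are treated in the same way.
    have ad : a * d ∈ integerRing σ := by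
      convert sub_mem (mul_mem aa dd) (mul_mem ac bd) using 1
      linear_combination -(a * d) * hdet
    have bc : b * c ∈ integerRing σ := by
      convert sub_mem ad o using 1; linear_combination -hdet
    have ab : a * b ∈ integerRing σ := by
      convert sub_mem (mul_mem aa bd) (mul_mem ac bb) using 1
      linear_combination -(a * b) * hdet
    have cd : c * d ∈ integerRing σ := by
      convert sub_mem (mul_mem ac dd) (mul_mem cc bd) using 1
      linear_combination -(c * d) * hdet
    intro i j k l
    fin_cases i <;> fin_cases j <;> fin_cases k <;> fin_cases l <;>
      first | assumption | (rw [mul_comm]; assumption)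
  · intro hM h
    refine ⟨hM.conj_mem, fun hh => ?_⟩
    have := hM.inv.conj_mem hh
    simpa [mul_assoc] using this

end Normalizer

/-! ### The square class δ of a normalizing matrix and its norm -/

section SquareClass

variable {K : Type*} [Field K]

/-- `M` is the product of `√(σ δ)` with a matrix over `K`. -/
def HasSquareClass (σ : K →+* ℝ) (M : SL(2, ℝ)) (δ : K) : Prop :=
  0 < σ δ ∧ ∃ P : Matrix (Fin 2) (Fin 2) K, ∀ i j, M i j = √(σ δ) * σ (P i j)

theorem HasSquareClass.mul {σ : K →+* ℝ} {M M' : SL(2, ℝ)} {δ δ' : K}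
    (h : HasSquareClass σ M δ) (h' : HasSquareClass σ M' δ') :
    HasSquareClass σ (M * M') (δ * δ') := by
  obtain ⟨h0, P, hP⟩ := h
  obtain ⟨h0', P', hP'⟩ := h'
  refine ⟨by rw [map_mul]; positivity, P * P', fun i j => ?_⟩
  rw [sl_mul_apply, hP, hP, hP', hP', Matrix.mul_apply, Fin.sum_univ_two, map_mul,
    Real.sqrt_mul h0.le]
  simp only [map_add, map_mul]
  ring

theorem HasSquareClass.inv {σ : K →+* ℝ} {M : SL(2, ℝ)} {δ : K}
    (h : HasSquareClass σ M δ) : HasSquareClass σ M⁻¹ δ := by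
  obtain ⟨h0, P, hP⟩ := h
  refine ⟨h0, P.adjugate, fun i j => ?_⟩
  obtain ⟨h1, h2, h3, h4⟩ := sl_inv_apply M
  rw [Matrix.adjugate_fin_two]
  fin_cases i <;> fin_cases j <;> simp [h1, h2, h3, h4, hP, -Matrix.SpecialLinearGroup.coe_inv]

theorem hasSquareClass_one (σ : K →+* ℝ) : HasSquareClass σ 1 1 := by
  refine ⟨by simp, 1, fun i j => ?_⟩
  fin_cases i <;> fin_cases j <;> simp

theorem exists_entry_ne_zero (M : SL(2, ℝ)) : ∃ i j, M i j ≠ 0 := by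
  by_contra! h
  have := sl_det M
  simp [h] at this

theorem HasSquareClass.of_eq_mul_sq {σ : K →+* ℝ} {M : SL(2, ℝ)} {δ ε y : K}
    (h : HasSquareClass σ M δ) (hy : δ = ε * y ^ 2) : HasSquareClass σ M ε := by
  wlog hp : 0 ≤ σ y generalizing y
  · exact this (y := -y) (by rw [hy, neg_sq]) (by rw [map_neg]; linarith)
  obtain ⟨h0, P, hP⟩ := h
  have he : σ δ = σ ε * σ y ^ 2 := by rw [hy, map_mul, map_pow]
  have h1 : 0 < σ ε := by
    rw [he] at h0
    exact pos_of_mul_pos_left h0 (by positivity)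
  refine ⟨h1, Matrix.of fun i j => y * P i j, fun i j => ?_⟩
  rw [hP, he, Real.sqrt_mul h1.le, Real.sqrt_sq hp, Matrix.of_apply, map_mul, mul_assoc]

/-- Squaring one nonzero entry of M in both representations compares δ with δ', so the class of δ
modulo squares is an invariant of M. -/
theorem HasSquareClass.exists_mul_sq_eq {σ : K →+* ℝ} {M : SL(2, ℝ)} {δ δ' : K}
    (h : HasSquareClass σ M δ) (h' : HasSquareClass σ M δ') :
    ∃ x y : K, x ≠ 0 ∧ y ≠ 0 ∧ δ * x ^ 2 = δ' * y ^ 2 := by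
  obtain ⟨h0, P, hP⟩ := h
  obtain ⟨h0', P', hP'⟩ := h'
  obtain ⟨i, j, hij⟩ := exists_entry_ne_zero M
  refine ⟨P i j, P' i j, ?_, ?_, ?_⟩
  · intro h; apply hij; rw [hP, h]; simp
  · intro h; apply hij; rw [hP', h]; simp
  · apply σ.injective
    have := congrArg (· ^ 2) ((hP i j).symm.trans (hP' i j))
    simpa only [mul_pow, Real.sq_sqrt h0.le, Real.sq_sqrt h0'.le, map_mul, map_pow] using this

theorem exists_common_denominator [NumberField K] (P : Matrix (Fin 2) (Fin 2) K) :
    ∃ n : ℕ, 0 < n ∧ ∃ L : Matrix (Fin 2) (Fin 2) (𝓞 K), ∀ i j, (L i j : K) = n * P i j := by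
  classical
  obtain ⟨y, hy, h⟩ := exists_integral_multiples ℤ ℚ (L := K)
    (Finset.univ.image fun p : Fin 2 × Fin 2 => P p.1 p.2)
  have h' : ∀ i j, IsIntegral ℤ (y.natAbs * P i j) := by
    intro i j
    have h1 := h (P i j) (Finset.mem_image.2 ⟨(i, j), Finset.mem_univ _, rfl⟩)
    rw [zsmul_eq_mul] at h1
    rcases Int.natAbs_eq y with h2 | h2
    · rw [h2, Int.cast_natCast] at h1
      exact h1
    · rw [h2, Int.cast_neg, Int.cast_natCast, neg_mul] at h1
      simpa using h1.neg
  exact ⟨y.natAbs, Int.natAbs_pos.2 hy, Matrix.of fun i j => ⟨_, h' i j⟩, fun i j => rfl⟩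

theorem mem_sigmaSet_iff [NumberField K] {σ : K →+* ℝ} {M : SL(2, ℝ)} :
    M ∈ sigmaSet σ ↔ ∃ q : ℚ, HasSquareClass σ M q := by
  constructor
  · rintro ⟨ℓ, L, hℓ, h⟩
    have hℓ' : (0 : ℝ) < ℓ := by exact_mod_cast hℓ
    refine ⟨(ℓ : ℚ)⁻¹, by simpa using hℓ, Matrix.of fun i j => (L i j : K), fun i j => ?_⟩
    rw [h]
    simp [embedMatrix]
  · rintro ⟨q, h0, P, hP⟩
    obtain ⟨n, hn, L, hL⟩ := exists_common_denominator P
    have hq : 0 < q := by rw [map_ratCast] at h0; exact_mod_cast h0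
    have hnum : 0 < q.num := Rat.num_pos.2 hq
    have hnum' : (q.num.toNat : ℤ) = q.num := Int.toNat_of_nonneg hnum.le
    have hnumpos : 0 < q.num.toNat := by omega
    have hden := q.den_pos
    -- With q = a/b and L = nP, the identity √(a/b)·P = aL / √(a b n²) gives this ℓ.
    refine ⟨q.num.toNat * q.den * n ^ 2, Matrix.of fun i j => q.num.toNat * L i j, by positivity, ?_⟩
    ext i j
    have e1 : (q : ℝ) = (q.num.toNat : ℝ) / q.den := by
      have : ((q.num.toNat : ℤ) : ℝ) = q.num := by rw [hnum']
      rw [← Int.cast_natCast, this]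
      exact Rat.cast_def q
    rw [hP]
    simp only [embedMatrix, Matrix.smul_apply, Matrix.map_apply, Matrix.of_apply, smul_eq_mul,
      map_ratCast,
      map_mul, map_natCast, hL]
    rw [e1]
    push_cast
    have a1 : (0 : ℝ) < q.num.toNat := by exact_mod_cast hnumpos
    have a2 : (0 : ℝ) < q.den := by exact_mod_cast hden
    have a3 : (0 : ℝ) < n := by exact_mod_cast hn
    rw [Real.sqrt_mul (by positivity), Real.sqrt_sq a3.le, Real.sqrt_mul a1.le,
      Real.sqrt_div a1.le]
    have b1 := Real.sqrt_pos.2 a1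
    have b2 := Real.sqrt_pos.2 a2
    field_simp
    rw [Real.sq_sqrt a1.le, mul_comm]

/-- Conjugate matrices of `SL₂(K)`. -/
theorem areConjugate_map [NumberField K] (σ σ' : K →+* ℝ) (N : SL(2, K)) :
    AreConjugate σ σ' (Matrix.SpecialLinearGroup.map σ N)
      (Matrix.SpecialLinearGroup.map σ' N) := by
  obtain ⟨n, hn, L, hL⟩ := exists_common_denominator (N : Matrix (Fin 2) (Fin 2) K)
  have a3 : (n : ℝ) ≠ 0 := by exact_mod_cast hn.ne'
  have key : ∀ τ : K →+* ℝ, (Matrix.SpecialLinearGroup.map τ N : Matrix (Fin 2) (Fin 2) ℝ) =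
      (√((n ^ 2 : ℕ) : ℝ))⁻¹ • embedMatrix τ L := by
    intro τ
    ext i j
    simp only [embedMatrix, Matrix.smul_apply, Matrix.map_apply, smul_eq_mul, hL, map_mul,
      map_natCast]
    push_cast
    rw [Real.sqrt_sq (Nat.cast_nonneg n), inv_mul_cancel_left₀ a3]
    rfl
  exact ⟨n ^ 2, L, by positivity, key σ, key σ'⟩

/-- Take δ to be the square of a nonzero entry; every entry divided by that one is a quotient of
integral products, hence in K. -/
theorem HasIntegralProducts.exists_hasSquareClass {σ : K →+* ℝ} {M : SL(2, ℝ)}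
    (hM : HasIntegralProducts σ M) : ∃ δ : K, HasSquareClass σ M δ := by
  obtain ⟨k, l, hkl⟩ := exists_entry_ne_zero M
  have h := fun i j => mem_integerRing.1 (hM i j k l)
  choose y hy using h
  have hδ : σ (y k l) = M k l ^ 2 := by rw [hy, sq]
  have hpos : 0 < σ (y k l) := by rw [hδ]; positivity
  rcases lt_or_gt_of_ne hkl with hneg | hpos'
  · refine ⟨y k l, hpos, Matrix.of fun i j => -(y i j / y k l), fun i j => ?_⟩
    rw [hδ, Real.sqrt_sq_eq_abs, abs_of_neg hneg, Matrix.of_apply, map_neg, map_div₀, hδ, hy]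
    field_simp
  · refine ⟨y k l, hpos, Matrix.of fun i j => y i j / y k l, fun i j => ?_⟩
    rw [hδ, Real.sqrt_sq hpos'.le, Matrix.of_apply, map_div₀, hδ, hy]
    field_simp

open FractionalIdeal nonZeroDivisors in
-- Integrality of the products gives δI² ⊆ 𝓞_K for the ideal I of the entries of P, and the
-- determinant puts 1 into δI². Taking norms in δI² = 1 makes |N(δ)| a rational square.
theorem HasIntegralProducts.norm_eq_or [NumberField K] (hK : Module.finrank ℚ K = 2)
    {σ σ' : K →+* ℝ} (hσ : σ ≠ σ') {M : SL(2, ℝ)} (hM : HasIntegralProducts σ M) {δ : K}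
    (hδ : HasSquareClass σ M δ) :
    ∃ r : ℚ, 0 < r ∧ (σ δ * σ' δ = (r : ℝ) ^ 2 ∨ σ δ * σ' δ = -(r : ℝ) ^ 2) := by
  classical
  obtain ⟨h0, P, hP⟩ := hδ
  have hint : ∀ i j k l, ∃ y : 𝓞 K, (y : K) = δ * (P i j * P k l) := by
    intro i j k l
    obtain ⟨y, hy⟩ := mem_integerRing.1 (hM i j k l)
    refine ⟨y, σ.injective ?_⟩
    rw [hy, hP, hP, map_mul, map_mul, mul_mul_mul_comm, Real.mul_self_sqrt h0.le]
  have hdet : δ * (P 0 0 * P 1 1) - δ * (P 0 1 * P 1 0) = 1 := by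
    apply σ.injective
    have := sl_det M
    rw [hP, hP, hP, hP] at this
    simp only [map_sub, map_mul, map_one]
    rw [← Real.mul_self_sqrt h0.le]
    linear_combination this
  let I : FractionalIdeal (𝓞 K)⁰ K :=
    spanFinset (𝓞 K) Finset.univ fun p : Fin 2 × Fin 2 => P p.1 p.2
  have hmem : ∀ i j, P i j ∈ I := fun i j =>
    Submodule.subset_span ⟨(i, j), by simp, rfl⟩
  have hI : spanSingleton (𝓞 K)⁰ δ * (I * I) = 1 := by
    apply le_antisymm
    · rw [← coe_le_coe, FractionalIdeal.coe_mul, FractionalIdeal.coe_mul, coe_spanSingleton,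
        spanFinset_coe, Submodule.span_mul_span, Submodule.span_mul_span, Submodule.span_le]
      rintro _ ⟨_, rfl, _, ⟨_, ⟨p, -, rfl⟩, _, ⟨p', -, rfl⟩, rfl⟩, rfl⟩
      obtain ⟨y, hy⟩ := hint p.1 p.2 p'.1 p'.2
      exact (mem_one_iff (𝓞 K)⁰).2 ⟨y, hy⟩
    · rw [FractionalIdeal.one_le, ← hdet]
      have hm : ∀ i j k l, δ * (P i j * P k l) ∈ spanSingleton (𝓞 K)⁰ δ * (I * I) :=
        fun i j k l => mul_mem_mul (mem_spanSingleton_self _ _)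
          (mul_mem_mul (hmem _ _) (hmem _ _))
      exact Submodule.sub_mem (M := K) _ (mem_coe.2 (hm _ _ _ _)) (mem_coe.2 (hm _ _ _ _))
  have hN := congrArg absNorm hI
  rw [map_mul, map_mul, map_one, absNorm_span_singleton] at hN
  have hI0 : absNorm I ≠ 0 := by
    intro h
    rw [h] at hN
    simp at hN
  have hI1 : 0 < absNorm I := lt_of_le_of_ne (absNorm_nonneg I) hI0.symm
  refine ⟨(absNorm I)⁻¹, inv_pos.2 hI1, ?_⟩
  have hN' : |Algebra.norm ℚ δ| = ((absNorm I)⁻¹) ^ 2 := by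
    field_simp
    linarith
  rw [← norm_eq_mul_embeddings hK hσ]
  rcases abs_eq (by positivity) |>.1 hN' with h | h
  · left; exact_mod_cast h
  · right; exact_mod_cast h

theorem HasSquareClass.mem_sigmaSet_of_norm_eq_sq [NumberField K] (hK : Module.finrank ℚ K = 2)
    {σ σ' : K →+* ℝ} (hσ : σ ≠ σ') {M : SL(2, ℝ)} {δ : K}
    (hδ : HasSquareClass σ M δ) {r : ℚ} (hr : 0 < r) (h : σ δ * σ' δ = (r : ℝ) ^ 2) :
    M ∈ sigmaSet σ := by
  rw [mem_sigmaSet_iff]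
  by_cases hz : δ = -r
  · exact ⟨-r, by rw [Rat.cast_neg, ← hz]; exact hδ⟩
  have hr' : (r : K) ≠ 0 := by exact_mod_cast hr.ne'
  have hr'' : (r : ℝ) ≠ 0 := by exact_mod_cast hr.ne'
  have hy0 : (r : K) + δ ≠ 0 := fun h => hz (by linear_combination h)
  set n := Algebra.norm ℚ ((r : K) + δ) with hn
  have hnr : (n : ℝ) = σ (r + δ) * σ' (r + δ) := norm_eq_mul_embeddings hK hσ _
  have hn0 : (n : K) ≠ 0 := by
    have : n ≠ 0 := by rw [hn]; simpa [Algebra.norm_eq_zero_iff] using hy0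
    exact_mod_cast this
  refine ⟨r / n, hδ.of_eq_mul_sq (y := r + δ) ?_⟩
  -- Since δδ' = r², one has δ(r + δ') = r(r + δ); multiplying by r + δ shows that δ is rational
  -- modulo squares.
  have key : δ * n = r * ((r : K) + δ) ^ 2 := by
    apply σ.injective
    rw [map_mul, map_ratCast, hnr]
    simp only [map_add, map_mul, map_pow, map_ratCast]
    linear_combination ((r : ℝ) + σ δ) * h
  push_cast
  field_simp
  exact key

theorem HasSquareClass.pos_of_mem_sigmaSet [NumberField K]
    {σ σ' : K →+* ℝ} {M : SL(2, ℝ)} {δ : K}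
    (hδ : HasSquareClass σ M δ) (hM : M ∈ sigmaSet σ) : 0 < σ' δ := by
  obtain ⟨q, hq⟩ := mem_sigmaSet_iff.1 hM
  obtain ⟨x, y, hx, hy, h⟩ := hδ.exists_mul_sq_eq hq
  have hq0 := hq.1
  rw [map_ratCast] at hq0
  have h' := congrArg σ' h
  rw [map_mul, map_mul, map_pow, map_pow, map_ratCast] at h'
  have hx' : σ' x ≠ 0 := by simpa using hx
  have hy' : σ' y ≠ 0 := by simpa using hy
  have : 0 < σ' δ * σ' x ^ 2 := by rw [h']; positivity
  exact pos_of_mul_pos_left this (by positivity)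

end SquareClass

/-! ### N_K ∩ Σ_K acts discontinuously -/

section Discontinuous

variable {K : Type*} [Field K]

/-- The action of SL₂(ℝ) on ℍ is proper, so the matrices moving a point of C into C form a compact
set. -/
theorem exists_entry_bound {C : Set ℍ} (hC : IsCompact C) :
    ∃ B : ℝ, ∀ M : SL(2, ℝ), (∃ τ ∈ C, M • τ ∈ C) → ∀ i j, |M i j| ≤ B := by
  have hpre : IsCompact ((fun p : SL(2, ℝ) × ℍ => (p.1 • p.2, p.2)) ⁻¹' (C ×ˢ C)) :=
    ProperSMul.isProperMap_smul_pair.isCompact_preimage (hC.prod hC)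
  have hfst := hpre.image continuous_fst
  have hcont : ∀ i j, Continuous fun M : SL(2, ℝ) => M i j := fun i j =>
    (continuous_subtype_val (p := fun A : Matrix (Fin 2) (Fin 2) ℝ => A.det = 1)).matrix_elem i j
  have hb : ∀ i j, ∃ B : ℝ, ∀ M : SL(2, ℝ), (∃ τ ∈ C, M • τ ∈ C) → |M i j| ≤ B := by
    intro i j
    obtain ⟨B, hB⟩ := hfst.exists_bound_of_continuousOn (hcont i j).continuousOn
    refine ⟨B, ?_⟩
    rintro M ⟨τ, hτ, hMτ⟩
    exact hB M ⟨(M, τ), ⟨hMτ, hτ⟩, rfl⟩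
  choose B hB using hb
  refine ⟨∑ i, ∑ j, |B i j|, fun M hM i j => ?_⟩
  calc |M i j| ≤ |B i j| := (hB i j M hM).trans (le_abs_self _)
    _ ≤ ∑ j, |B i j| := Finset.single_le_sum (f := fun j => |B i j|)
        (fun _ _ => abs_nonneg _) (Finset.mem_univ j)
    _ ≤ ∑ i, ∑ j, |B i j| := Finset.single_le_sum (f := fun i => ∑ j, |B i j|)
        (fun _ _ => Finset.sum_nonneg fun _ _ => abs_nonneg _) (Finset.mem_univ i)

theorem finite_of_entries_mem {S : Set ℝ} (hS : S.Finite) :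
    {M : SL(2, ℝ) | ∀ i j, M i j ∈ S}.Finite := by
  have h1 : {f : Fin 2 → Fin 2 → ℝ | ∀ i, f i ∈ {g : Fin 2 → ℝ | ∀ j, g j ∈ S}}.Finite :=
    Set.Finite.pi' fun _ => Set.Finite.pi' fun _ => hS
  refine Set.Finite.preimage (f := fun M : SL(2, ℝ) => fun i j => M i j) ?_ h1
  intro M _ M' _ h
  ext i j
  exact congrFun (congrFun h i) j

/-- The intersection of the normalizer with `Σ_K`. -/
def normalizerInter [NumberField K] (σ : K →+* ℝ) : Subgroup SL(2, ℝ) where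
  carrier := normalizerGroup σ ∩ sigmaSet σ
  mul_mem' := by
    rintro M M' ⟨h1, h2⟩ ⟨h1', h2'⟩
    rw [normalizerGroup_eq] at *
    obtain ⟨q, hq⟩ := mem_sigmaSet_iff.1 h2
    obtain ⟨q', hq'⟩ := mem_sigmaSet_iff.1 h2'
    exact ⟨mul_mem h1 h1', mem_sigmaSet_iff.2 ⟨q * q', by simpa using hq.mul hq'⟩⟩
  one_mem' := by
    rw [normalizerGroup_eq]
    exact ⟨one_mem _, mem_sigmaSet_iff.2 ⟨1, by simpa using hasSquareClass_one σ⟩⟩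
  inv_mem' := by
    rintro M ⟨h1, h2⟩
    rw [normalizerGroup_eq] at *
    obtain ⟨q, hq⟩ := mem_sigmaSet_iff.1 h2
    exact ⟨inv_mem h1, mem_sigmaSet_iff.2 ⟨q, hq.inv⟩⟩

theorem hilbertModularGroup_le_normalizerInter [NumberField K] (σ : K →+* ℝ) :
    hilbertModularGroup σ ≤ normalizerInter σ := by
  intro M hM
  refine ⟨?_, ?_⟩
  · rw [normalizerGroup_eq]
    exact Subgroup.le_normalizer hM
  · obtain ⟨L, rfl⟩ := hM
    refine ⟨1, L, one_pos, ?_⟩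
    ext i j
    simp [embedMatrix]

theorem actsDiscontinuously_normalizerInter [NumberField K] (hK : Module.finrank ℚ K = 2)
    {σ σ' : K →+* ℝ} (hσ : σ ≠ σ') : ActsDiscontinuously σ σ' (normalizerInter σ) := by
  intro C hC
  obtain ⟨B₁, h₁⟩ := exists_entry_bound (hC.image continuous_fst)
  obtain ⟨B₂, h₂⟩ := exists_entry_bound (hC.image continuous_snd)
  have hF := finite_integers_bounded hK hσ (max (B₁ ^ 2) (B₂ ^ 2))
  set F := {x : 𝓞 K | |σ x| ≤ max (B₁ ^ 2) (B₂ ^ 2) ∧ |σ' x| ≤ max (B₁ ^ 2) (B₂ ^ 2)}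
  -- Squares of entries of M come from some x in 𝓞_K whose other conjugate is the squared entry of
  -- M'. Only finitely many x have both conjugates bounded, and each allows two values ±√(σ x).
  have hS : {t : ℝ | ∃ x ∈ F, t ^ 2 = σ x}.Finite := by
    refine ((hF.image fun x : 𝓞 K => √(σ x)).union (hF.image fun x : 𝓞 K => -√(σ x))).subset ?_
    rintro t ⟨x, hx, ht⟩
    rcases le_total 0 t with h | h
    · left
      exact ⟨x, hx, by simp only [← ht, Real.sqrt_sq h]⟩
    · right
      exact ⟨x, hx, by simp only [← ht, Real.sqrt_sq_eq_abs, abs_of_nonpos h, neg_neg]⟩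
  refine (finite_of_entries_mem hS).subset ?_
  rintro M ⟨hM, M', ⟨ℓ, L, hℓ, hL, hL'⟩, τ, hτ, hMτ⟩ i j
  have hℓ' : (0 : ℝ) < ℓ := by exact_mod_cast hℓ
  obtain ⟨x, hx⟩ := mem_integerRing.1 (mem_normalizerGroup_iff.1 hM.1 i j i j)
  have e : ∀ A : SL(2, ℝ), ∀ τ : K →+* ℝ, (A : Matrix (Fin 2) (Fin 2) ℝ) =
      (√(ℓ : ℝ))⁻¹ • embedMatrix τ L → A i j ^ 2 = (ℓ : ℝ)⁻¹ * τ (L i j) ^ 2 := by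
    intro A τ h
    rw [h]
    simp only [embedMatrix, Matrix.smul_apply, Matrix.map_apply, smul_eq_mul, mul_pow, inv_pow,
      Real.sq_sqrt hℓ'.le]
  have e1 := e M σ hL
  have e2 := e M' σ' hL'
  have hxK : (x : K) = (ℓ : K)⁻¹ * (L i j : K) ^ 2 := by
    apply σ.injective
    rw [hx, ← sq, e1]
    simp
  have e3 : M' i j ^ 2 = σ' x := by
    rw [e2, hxK]
    simp
  refine ⟨x, ⟨?_, ?_⟩, by rw [hx, sq]⟩
  · rw [hx, ← sq, abs_of_nonneg (sq_nonneg _)]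
    refine le_max_of_le_left ?_
    rw [← sq_abs]
    exact pow_le_pow_left₀ (abs_nonneg _)
      (h₁ M ⟨τ.1, Set.mem_image_of_mem _ hτ, ⟨_, hMτ, rfl⟩⟩ i j) 2
  · rw [← e3, abs_of_nonneg (sq_nonneg _)]
    refine le_max_of_le_right ?_
    rw [← sq_abs]
    exact pow_le_pow_left₀ (abs_nonneg _)
      (h₂ M' ⟨τ.2, Set.mem_image_of_mem _ hτ, ⟨_, hMτ, rfl⟩⟩ i j) 2

theorem normalizerInter_mem_discontinuousExtensions [NumberField K]
    (hK : Module.finrank ℚ K = 2) {σ σ' : K →+* ℝ} (hσ : σ ≠ σ') :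
    normalizerInter σ ∈ discontinuousExtensions σ σ' :=
  ⟨hilbertModularGroup_le_normalizerInter σ, fun _ h => h.2,
    actsDiscontinuously_normalizerInter hK hσ⟩

end Discontinuous

/-! ### Groups between SL₂(𝓞_K) and SL₂(K) with a lattice of translations -/

section Overgroups

open nonZeroDivisors

variable {K : Type*} [Field K]

/-- The translation matrix with rows `(1, x)` and `(0, 1)`. -/
def translation {R : Type*} [CommRing R] (x : R) : SL(2, R) := ⟨!![1, x; 0, 1], by simp⟩

theorem translation_apply {R : Type*} [CommRing R] (x : R) :
    translation x 0 0 = 1 ∧ translation x 0 1 = x ∧ translation x 1 0 = 0 ∧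
      translation x 1 1 = 1 := by
  simp [translation]

theorem sl_ext {R : Type*} [CommRing R] {A B : SL(2, R)} (h00 : A 0 0 = B 0 0)
    (h01 : A 0 1 = B 0 1) (h10 : A 1 0 = B 1 0) (h11 : A 1 1 = B 1 1) : A = B := by
  ext i j
  fin_cases i <;> fin_cases j <;> assumption

theorem translation_add {R : Type*} [CommRing R] (x y : R) :
    translation (x + y) = translation x * translation y := by
  apply sl_ext <;> simp only [sl_mul_apply, translation_apply] <;> ring

theorem translation_zero {R : Type*} [CommRing R] : translation (0 : R) = 1 := by
  apply sl_ext <;> simp [translation]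

theorem translation_neg {R : Type*} [CommRing R] (x : R) :
    translation (-x) = (translation x)⁻¹ := by
  rw [eq_inv_iff_mul_eq_one, ← translation_add, neg_add_cancel, translation_zero]

theorem conj_translation {R : Type*} [CommRing R] {N : SL(2, R)} (hN : N 1 0 = 0) (x : R) :
    N * translation x * N⁻¹ = translation (N 0 0 ^ 2 * x) := by
  have hd := sl_det N
  rw [hN] at hd
  apply sl_ext <;> simp only [sl_mul_apply, translation_apply, sl_inv_apply N, hN]
  · linear_combination hd
  · ring
  · ring
  · linear_combination hd

/-- The subgroup of those `x` whose translation matrix lies in `H`. -/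
def translationLattice (H : Subgroup SL(2, K)) : Submodule ℤ K :=
  AddSubgroup.toIntSubmodule
    { carrier := {x | translation x ∈ H}
      add_mem' := fun {x y} hx hy => by
        rw [Set.mem_ofPred_eq, translation_add]
        exact mul_mem hx hy
      zero_mem' := by
        rw [Set.mem_ofPred_eq, translation_zero]
        exact one_mem _
      neg_mem' := fun {x} hx => by
        rw [Set.mem_ofPred_eq, translation_neg]
        exact inv_mem hx }

theorem mem_translationLattice {H : Subgroup SL(2, K)} {x : K} :
    x ∈ translationLattice H ↔ translation x ∈ H := Iff.rfl

/-- The group `SL₂(𝓞 K)` inside `SL₂(K)`. -/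
def integralSL (K : Type*) [Field K] : Subgroup SL(2, K) :=
  (Matrix.SpecialLinearGroup.map (n := Fin 2) (algebraMap (𝓞 K) K)).range

theorem mem_integralSL {N : SL(2, K)} :
    N ∈ integralSL K ↔ ∀ i j, ∃ y : 𝓞 K, (y : K) = N i j := by
  constructor
  · rintro ⟨L, rfl⟩ i j
    exact ⟨L i j, rfl⟩
  · exact mem_range_map_of_forall_mem RingOfIntegers.coe_injective

/-- Conjugation by N multiplies the translation lattice by the square of the upper left entry; an
element preserving a nonzero finitely generated ℤ-module is integral. -/
theorem isIntegral_of_lower_left_eq_zero {H : Subgroup SL(2, K)} (hH : integralSL K ≤ H)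
    (hfg : (translationLattice H).FG) {N : SL(2, K)} (hN : N ∈ H) (h0 : N 1 0 = 0) :
    IsIntegral ℤ (N 0 0) := by
  refine IsIntegral.of_pow (n := 2) (by norm_num)
    (isIntegral_of_smul_mem_submodule (translationLattice H) ?_ hfg _ ?_)
  · intro h
    have h1 : (1 : K) ∈ translationLattice H := by
      apply hH
      rw [mem_integralSL]
      intro i j
      fin_cases i <;> fin_cases j
      · exact ⟨1, by simp [translation]⟩
      · exact ⟨1, by simp [translation]⟩
      · exact ⟨0, by simp [translation]⟩
      · exact ⟨1, by simp [translation]⟩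
    rw [h] at h1
    exact one_ne_zero ((Submodule.mem_bot ℤ).1 h1)
  · intro x hx
    rw [mem_translationLattice, smul_eq_mul, ← conj_translation h0]
    exact mul_mem (mul_mem hN hx) (inv_mem hN)

/-- The module generated by the entries of the elements of a group. -/
def entryModule (H : Subgroup SL(2, K)) : Submodule (𝓞 K) K :=
  Submodule.span (𝓞 K) {x | ∃ N ∈ H, ∃ i j, N i j = x}

theorem entryModule_mul_le {H : Subgroup SL(2, K)} (hH : integralSL K ≤ H) :
    entryModule H * entryModule H ≤ entryModule H := by
  rw [entryModule, Submodule.span_mul_span, Submodule.span_le]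
  rintro _ ⟨_, ⟨N, hN, i, j, rfl⟩, _, ⟨N', hN', k, l, rfl⟩, rfl⟩
  let T : SL(2, K) := translation 1
  let T' : SL(2, K) := ⟨!![1, 0; 1, 1], by simp⟩
  have hT : T ∈ H := by
    apply hH
    rw [mem_integralSL]
    intro i j
    fin_cases i <;> fin_cases j
    · exact ⟨1, by simp [T, translation]⟩
    · exact ⟨1, by simp [T, translation]⟩
    · exact ⟨0, by simp [T, translation]⟩
    · exact ⟨1, by simp [T, translation]⟩
  have hT' : T' ∈ H := by
    apply hH
    rw [mem_integralSL]
    intro i j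
    fin_cases i <;> fin_cases j
    · exact ⟨1, by simp [T']⟩
    · exact ⟨0, by simp [T']⟩
    · exact ⟨1, by simp [T']⟩
    · exact ⟨1, by simp [T']⟩
  have hm : ∀ A ∈ H, ∀ i j, A i j ∈ entryModule H := fun A hA i j =>
    Submodule.subset_span ⟨A, hA, i, j, rfl⟩
  have t1 : T 0 0 = 1 ∧ T 0 1 = 1 ∧ T 1 0 = 0 ∧ T 1 1 = 1 := translation_apply 1
  have t2 : T' 0 0 = 1 ∧ T' 0 1 = 0 ∧ T' 1 0 = 1 ∧ T' 1 1 = 1 := by simp [T']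
  -- The four matrix units are integral combinations of 1, T, T' and TT'; inserting them between N
  -- and N' isolates each product of two entries.
  have m1 := hm _ (mul_mem hN hN') i l
  have mT := hm _ (mul_mem (mul_mem hN hT) hN') i l
  have mT' := hm _ (mul_mem (mul_mem hN hT') hN') i l
  have mTT' := hm _ (mul_mem (mul_mem (mul_mem hN hT) hT') hN') i l
  simp only [sl_mul_apply, t1, t2, mul_one, mul_zero, add_zero, zero_add] at m1 mT mT' mTT'
  change N i j * N' k l ∈ entryModule H
  have e01 : N i 0 * N' 1 l ∈ entryModule H := by
    convert sub_mem mT m1 using 1; ring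
  have e10 : N i 1 * N' 0 l ∈ entryModule H := by
    convert sub_mem mT' m1 using 1; ring
  have e00 : N i 0 * N' 0 l ∈ entryModule H := by
    convert add_mem (sub_mem (sub_mem mTT' mT) mT') m1 using 1; ring
  have e11 : N i 1 * N' 1 l ∈ entryModule H := by
    convert sub_mem m1 e00 using 1; ring
  fin_cases j <;> fin_cases k <;> assumption

variable [NumberField K]

/-- The fractional ideal generated by the first column of `N`. -/
def columnIdeal (N : SL(2, K)) : FractionalIdeal (𝓞 K)⁰ K :=
  .spanSingleton _ (N 0 0) + .spanSingleton _ (N 1 0)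

theorem entry_mem_columnIdeal (N : SL(2, K)) (i : Fin 2) : N i 0 ∈ columnIdeal N := by
  rw [columnIdeal, FractionalIdeal.mem_add]
  fin_cases i
  · exact ⟨_, FractionalIdeal.mem_spanSingleton_self _ _, 0, FractionalIdeal.zero_mem _, add_zero _⟩
  · exact ⟨0, FractionalIdeal.zero_mem _, _, FractionalIdeal.mem_spanSingleton_self _ _, zero_add _⟩

theorem columnIdeal_ne_zero (N : SL(2, K)) : columnIdeal N ≠ 0 := by
  intro h
  have h0 := entry_mem_columnIdeal N 0
  have h1 := entry_mem_columnIdeal N 1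
  rw [h, FractionalIdeal.mem_zero_iff] at h0 h1
  have := sl_det N
  rw [h0, h1] at this
  simp at this

/-- A generating pair of a fractional ideal is the first column of a matrix of determinant one with
second column in the inverse ideal. -/
theorem exists_completion {J : FractionalIdeal (𝓞 K)⁰ K} (hJ : J ≠ 0) {a c : K}
    (h : J = .spanSingleton _ a + .spanSingleton _ c) :
    ∃ b ∈ J⁻¹, ∃ d ∈ J⁻¹, a * d - b * c = 1 := by
  have h1 : (1 : K) ∈ J * J⁻¹ := by
    rw [mul_inv_cancel₀ hJ]
    exact FractionalIdeal.one_mem_one _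
  nth_rewrite 1 [h] at h1
  rw [add_mul, FractionalIdeal.mem_add] at h1
  obtain ⟨x, hx, y, hy, hxy⟩ := h1
  obtain ⟨d, hd, rfl⟩ := FractionalIdeal.mem_singleton_mul.1 hx
  obtain ⟨b, hb, rfl⟩ := FractionalIdeal.mem_singleton_mul.1 hy
  refine ⟨-b, FractionalIdeal.mem_coe.1 (Submodule.neg_mem _ (FractionalIdeal.mem_coe.2 hb)), d, hd, ?_⟩
  linear_combination hxy

/-- The group `SL₂(𝓞 K)` acts transitively on the generating pairs of a fractional ideal. -/
theorem exists_integralSL_of_ideal_eq {J : FractionalIdeal (𝓞 K)⁰ K} (hJ : J ≠ 0) {a c a' c' : K}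
    (h : J = .spanSingleton _ a + .spanSingleton _ c)
    (h' : J = .spanSingleton _ a' + .spanSingleton _ c') :
    ∃ g ∈ integralSL K, g 0 0 * a + g 0 1 * c = a' ∧ g 1 0 * a + g 1 1 * c = c' := by
  obtain ⟨b, hb, d, hd, hdet⟩ := exists_completion hJ h
  obtain ⟨b', hb', d', hd', hdet'⟩ := exists_completion hJ h'
  have ha : ∀ {x y : K}, J = .spanSingleton _ x + .spanSingleton _ y → x ∈ J ∧ y ∈ J := by
    intro x y hxy
    rw [hxy]
    simp only [FractionalIdeal.mem_add]
    exact ⟨⟨_, FractionalIdeal.mem_spanSingleton_self _ _, 0, FractionalIdeal.zero_mem _,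
      add_zero _⟩, ⟨0, FractionalIdeal.zero_mem _, _, FractionalIdeal.mem_spanSingleton_self _ _, zero_add _⟩⟩
  obtain ⟨ha0, hc0⟩ := ha h
  obtain ⟨ha1, hc1⟩ := ha h'
  have key : ∀ {x y z w : K}, x ∈ J → y ∈ J⁻¹ → z ∈ J → w ∈ J⁻¹ →
      ∃ t : 𝓞 K, (t : K) = x * y - z * w := by
    intro x y z w hx hy hz hw
    have hp : ∀ {x y : K}, x ∈ J → y ∈ J⁻¹ → ∃ t : 𝓞 K, (t : K) = x * y := by
      intro x y hx hy
      have := FractionalIdeal.mul_mem_mul hx hy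
      rw [mul_inv_cancel₀ hJ] at this
      exact (FractionalIdeal.mem_one_iff _).1 this
    obtain ⟨t, ht⟩ := hp hx hy
    obtain ⟨u, hu⟩ := hp hz hw
    exact ⟨t - u, (map_sub (algebraMap (𝓞 K) K) t u).trans (congrArg₂ (· - ·) ht hu)⟩
  -- This is the completed matrix of (a', c') times the inverse of that of (a, c).
  refine ⟨⟨!![a' * d - c * b', a * b' - a' * b; c' * d - c * d', a * d' - c' * b], ?_⟩, ?_, ?_, ?_⟩
  · rw [Matrix.det_fin_two_of]
    linear_combination (a' * d' - b' * c') * hdet + hdet'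
  · refine mem_integralSL.2 fun i j => ?_
    fin_cases i <;> fin_cases j
    · exact key ha1 hd hc0 hb'
    · exact key ha0 hb' ha1 hb
    · exact key hc1 hd hc0 hd'
    · exact key ha0 hd' hc1 hb
  · simp only [Matrix.of_apply, Matrix.cons_val_zero, Matrix.cons_val_one, Matrix.cons_val',
      Matrix.cons_val_fin_one]
    linear_combination a' * hdet
  · simp only [Matrix.of_apply, Matrix.cons_val_zero, Matrix.cons_val_one, Matrix.cons_val',
      Matrix.cons_val_fin_one]
    linear_combination c' * hdet

/-- After an integral change g, the first column of N' is t times that of N, so N⁻¹ g N' is upper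
triangular with corner t. Both t and t⁻¹ are then integral, so t is a unit. -/
theorem columnIdeal_eq_of_eq_mul {H : Subgroup SL(2, K)} (hH : integralSL K ≤ H)
    (hfg : (translationLattice H).FG) {N N' : SL(2, K)} (hN : N ∈ H) (hN' : N' ∈ H) {t : K}
    (ht : columnIdeal N' = .spanSingleton _ t * columnIdeal N) :
    columnIdeal N' = columnIdeal N := by
  have hu : columnIdeal N' = .spanSingleton _ (t * N 0 0) + .spanSingleton _ (t * N 1 0) := by
    rw [ht, columnIdeal, mul_add, FractionalIdeal.spanSingleton_mul_spanSingleton,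
      FractionalIdeal.spanSingleton_mul_spanSingleton]
  obtain ⟨g, hg, h0, h1⟩ := exists_integralSL_of_ideal_eq (columnIdeal_ne_zero N')
    (h := rfl) (h' := hu)
  have hU : N⁻¹ * (g * N') ∈ H := mul_mem (inv_mem hN) (mul_mem (hH hg) hN')
  set U := N⁻¹ * (g * N') with hUdef
  have hd := sl_det N
  have h00 : U 0 0 = t := by
    rw [hUdef]
    simp only [sl_mul_apply _ (g * N'), sl_mul_apply g, h0, h1, sl_inv_apply N]
    linear_combination t * hd
  have h10 : U 1 0 = 0 := by
    rw [hUdef]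
    simp only [sl_mul_apply _ (g * N'), sl_mul_apply g, h0, h1, sl_inv_apply N]
    ring
  have hdU := sl_det U
  rw [h10, h00, mul_zero, sub_zero] at hdU
  have i1 := isIntegral_of_lower_left_eq_zero hH hfg hU h10
  have i2 := isIntegral_of_lower_left_eq_zero hH hfg (inv_mem hU)
    (by rw [(sl_inv_apply U).2.2.1, h10, neg_zero])
  rw [h00] at i1
  rw [(sl_inv_apply U).1] at i2
  have hspan : (FractionalIdeal.spanSingleton (𝓞 K)⁰ t) = 1 := by
    apply le_antisymm
    · rw [FractionalIdeal.spanSingleton_le_iff_mem, FractionalIdeal.mem_one_iff]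
      exact ⟨⟨t, i1⟩, rfl⟩
    · rw [FractionalIdeal.one_le, FractionalIdeal.mem_spanSingleton]
      refine ⟨⟨U 1 1, i2⟩, ?_⟩
      rw [mul_comm] at hdU
      exact hdU
  rw [ht, hspan, one_mul]

theorem finite_columnIdeals {H : Subgroup SL(2, K)} (hH : integralSL K ≤ H)
    (hfg : (translationLattice H).FG) : (columnIdeal '' (H : Set SL(2, K))).Finite := by
  classical
  -- The ideal class separates column ideals, so finiteness of the class group suffices. The value 1
  -- at the zero ideal is a dummy.
  let f : FractionalIdeal (𝓞 K)⁰ K → ClassGroup (𝓞 K) := fun J =>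
    if h : J ≠ 0 then ClassGroup.mk K (Units.mk0 J h) else 1
  refine Set.Finite.of_finite_image (f := f) (Set.toFinite _) ?_
  rintro _ ⟨N, hN, rfl⟩ _ ⟨N', hN', rfl⟩ hf
  simp only [f, columnIdeal_ne_zero, ne_eq, not_false_eq_true, dif_pos] at hf
  rw [← mul_inv_eq_one, ← map_inv, ← map_mul, ClassGroup.mk_eq_one_iff] at hf
  obtain ⟨t, ht⟩ := hf
  refine columnIdeal_eq_of_eq_mul hH hfg hN' hN (t := t) ?_
  have h1 : columnIdeal N * (columnIdeal N')⁻¹ = FractionalIdeal.spanSingleton (𝓞 K)⁰ t := by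
    apply FractionalIdeal.coeToSubmodule_injective
    change ((columnIdeal N * (columnIdeal N')⁻¹ : FractionalIdeal (𝓞 K)⁰ K) : Submodule (𝓞 K) K) =
      (FractionalIdeal.spanSingleton (𝓞 K)⁰ t : FractionalIdeal (𝓞 K)⁰ K)
    rw [FractionalIdeal.coe_spanSingleton, ← ht]
    simp
  rw [← h1, inv_mul_cancel_right₀ (columnIdeal_ne_zero N')]

theorem exists_ideal_of_entries {H : Subgroup SL(2, K)} (hH : integralSL K ≤ H)
    (hfg : (translationLattice H).FG) :
    ∃ I : FractionalIdeal (𝓞 K)⁰ K, ∀ N ∈ H, ∀ i j, N i j ∈ I := by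
  have hfin := finite_columnIdeals hH hfg
  have hcol : ∀ N ∈ H, ∀ i, N i 0 ∈ hfin.toFinset.sup id := by
    intro N hN i
    have hle : columnIdeal N ≤ hfin.toFinset.sup id :=
      Finset.le_sup (f := id) (hfin.mem_toFinset.2 ⟨N, hN, rfl⟩)
    exact hle (entry_mem_columnIdeal N i)
  refine ⟨hfin.toFinset.sup id, fun N hN i j => ?_⟩
  fin_cases j
  · exact hcol N hN i
  -- The second column of N is the first column of N S.
  · let S : SL(2, K) := ⟨!![0, -1; 1, 0], by simp⟩
    have hS : S ∈ integralSL K := by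
      rw [mem_integralSL]
      intro i j
      fin_cases i <;> fin_cases j
      · exact ⟨0, by simp [S]⟩
      · exact ⟨-1, by simp [S]⟩
      · exact ⟨1, by simp [S]⟩
      · exact ⟨0, by simp [S]⟩
    have h := hcol (N * S) (mul_mem hN (hH hS)) i
    rw [sl_mul_apply] at h
    simpa [S] using h

/-- A group containing `SL₂(𝓞 K)` whose translations form a lattice is `SL₂(𝓞 K)` itself. -/
theorem eq_integralSL {H : Subgroup SL(2, K)} (hH : integralSL K ≤ H)
    (hfg : (translationLattice H).FG) : H = integralSL K := by
  refine le_antisymm (fun N hN => ?_) hH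
  obtain ⟨I, hI⟩ := exists_ideal_of_entries hH hfg
  have hle : entryModule H ≤ I := by
    rw [entryModule, Submodule.span_le]
    rintro _ ⟨N, hN, i, j, rfl⟩
    exact hI N hN i j
  -- The entry module is a finitely generated 𝓞_K-module preserved by multiplication with every
  -- entry, which makes the entries integral.
  have hBfg : (entryModule H).FG :=
    isNoetherian_submodule.1 (FractionalIdeal.isNoetherian I) _ hle
  rw [mem_integralSL]
  intro i j
  have hint : IsIntegral (𝓞 K) (N i j) := by
    refine isIntegral_of_smul_mem_submodule (entryModule H) ?_ hBfg _ ?_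
    · intro h
      have h1 : (1 : K) ∈ entryModule H :=
        Submodule.subset_span ⟨1, one_mem _, 0, 0, by simp⟩
      rw [h] at h1
      exact one_ne_zero ((Submodule.mem_bot _).1 h1)
    · intro x hx
      exact entryModule_mul_le hH
        (Submodule.mul_mem_mul (Submodule.subset_span ⟨N, hN, i, j, rfl⟩) hx)
  exact ⟨⟨_, isIntegral_trans (R := ℤ) _ hint⟩, rfl⟩

end Overgroups

/-! ### Every discontinuous extension normalizes Γ_K -/

section Maximality

variable {K : Type*} [Field K]

theorem translation_smul_I (x : ℝ) :
    translation x • UpperHalfPlane.I = x +ᵥ UpperHalfPlane.I := by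
  apply UpperHalfPlane.ext
  rw [UpperHalfPlane.specialLinearGroup_apply]
  simp [translation]
  ring

theorem map_translation (σ : K →+* ℝ) (x : K) :
    Matrix.SpecialLinearGroup.map σ (translation x) = translation (σ x) := by
  apply sl_ext
  · exact map_one σ
  · rfl
  · exact map_zero σ
  · exact map_one σ

theorem translation_injective : Function.Injective (translation : ℝ → SL(2, ℝ)) := by
  intro x y h
  have := (translation_apply x).2.1
  rw [h, (translation_apply y).2.1] at this
  exact this.symm

variable [NumberField K]

theorem finite_bounded_translations {σ σ' : K →+* ℝ} {Γ : Subgroup SL(2, ℝ)}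
    (hΓ : ActsDiscontinuously σ σ' Γ) (B : ℝ) :
    {x : K | translation (σ x) ∈ Γ ∧ |σ x| ≤ B ∧ |σ' x| ≤ B}.Finite := by
  have hcont : Continuous fun p : ℝ × ℝ =>
      ((p.1 +ᵥ UpperHalfPlane.I, p.2 +ᵥ UpperHalfPlane.I) : ℍ × ℍ) := by
    have h1 : Continuous fun t : ℝ => t +ᵥ UpperHalfPlane.I := by
      rw [UpperHalfPlane.isEmbedding_coe.continuous_iff]
      simp only [Function.comp_def, UpperHalfPlane.coe_vadd]
      fun_prop
    exact (h1.comp continuous_fst).prodMk (h1.comp continuous_snd)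
  -- This compact set contains (i, i) and its image under every translation to be counted.
  let C := (fun p : ℝ × ℝ => ((p.1 +ᵥ UpperHalfPlane.I, p.2 +ᵥ UpperHalfPlane.I) : ℍ × ℍ)) ''
    (Set.Icc (-|B|) |B| ×ˢ Set.Icc (-|B|) |B|)
  have hC : IsCompact C := (isCompact_Icc.prod isCompact_Icc).image hcont
  refine Set.Finite.of_finite_image (f := fun x => translation (σ x)) ((hΓ C hC).subset ?_)
    (translation_injective.comp σ.injective).injOn
  rintro _ ⟨x, ⟨hx, h1, h2⟩, rfl⟩
  refine ⟨hx, translation (σ' x), ?_, (UpperHalfPlane.I, UpperHalfPlane.I), ?_, ?_⟩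
  · change AreConjugate σ σ' (translation (σ x)) _
    rw [← map_translation, ← map_translation]
    exact areConjugate_map σ σ' _
  · exact ⟨(0, 0), by simp, by simp⟩
  · refine ⟨(σ x, σ' x), ⟨abs_le.1 (h1.trans (le_abs_self B)),
      abs_le.1 (h2.trans (le_abs_self B))⟩, ?_⟩
    simp only [translation_smul_I]

/-- Modulo 𝓞_K every translation in Γ can be moved into a fixed bounded region, where discontinuity
leaves finitely many. -/
theorem fg_translationLattice (hK : Module.finrank ℚ K = 2) {σ σ' : K →+* ℝ}
    (hσ : σ ≠ σ') {m : ℕ} (hm1 : 1 < m) (hm : Squarefree m) {s : K} (hs : s ^ 2 = (m : K))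
    {Γ : Subgroup SL(2, ℝ)} (hH : hilbertModularGroup σ ≤ Γ) (hΓ : ActsDiscontinuously σ σ' Γ) :
    (translationLattice (Γ.comap (Matrix.SpecialLinearGroup.map (n := Fin 2) σ))).FG := by
  have hF := finite_bounded_translations hΓ (1 + |σ s|)
  set F := {x : K | translation (σ x) ∈ Γ ∧ |σ x| ≤ 1 + |σ s| ∧ |σ' x| ≤ 1 + |σ s|}
  let O : Submodule ℤ K := LinearMap.range ((Algebra.linearMap (𝓞 K) K).restrictScalars ℤ)
  have hfg : (Submodule.span ℤ F ⊔ O).FG :=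
    (Submodule.fg_span hF).sup (Submodule.FG.of_finite)
  have : IsNoetherian ℤ (Submodule.span ℤ F ⊔ O : Submodule ℤ K) :=
    isNoetherian_of_fg_of_noetherian _ hfg
  refine isNoetherian_submodule.1 this _ fun x hx => ?_
  rw [mem_translationLattice, Subgroup.mem_comap, map_translation] at hx
  obtain ⟨y, h1, h2⟩ := exists_integer_near hK hσ hm1 hm hs x
  have hy : translation (σ y) ∈ Γ := by
    apply hH
    rw [mem_hilbertModularGroup]
    intro i j
    fin_cases i <;> fin_cases j
    · exact ⟨1, by simp [translation]⟩
    · exact ⟨y, by simp [translation]⟩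
    · exact ⟨0, by simp [translation]⟩
    · exact ⟨1, by simp [translation]⟩
  have hxy : x - y ∈ F := by
    refine ⟨?_, h1, h2⟩
    rw [map_sub, sub_eq_add_neg, translation_add, translation_neg]
    exact mul_mem hx (inv_mem hy)
  rw [show x = (x - y) + y by ring]
  exact Submodule.add_mem_sup (Submodule.subset_span hxy) ⟨y, rfl⟩

theorem discontinuousExtension_le (hK : Module.finrank ℚ K = 2) {σ σ' : K →+* ℝ}
    (hσ : σ ≠ σ') {m : ℕ} (hm1 : 1 < m) (hm : Squarefree m) {s : K} (hs : s ^ 2 = (m : K))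
    {Γ : Subgroup SL(2, ℝ)} (h : Γ ∈ discontinuousExtensions σ σ') : Γ ≤ normalizerInter σ := by
  obtain ⟨hH, hsub, hΓ⟩ := h
  have hle : integralSL K ≤ Γ.comap (Matrix.SpecialLinearGroup.map (n := Fin 2) σ) := by
    rintro _ ⟨L, rfl⟩
    exact hH ⟨L, rfl⟩
  have heq := eq_integralSL hle (fg_translationLattice hK hσ hm1 hm hs hH hΓ)
  have hconj : ∀ M ∈ Γ, ∀ h ∈ hilbertModularGroup σ, M * h * M⁻¹ ∈ hilbertModularGroup σ := by
    intro M hM h hh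
    obtain ⟨q, h0, P, hP⟩ := mem_sigmaSet_iff.1 (hsub hM)
    -- M and M⁻¹ each carry a factor √q, so the conjugate has entries in K.
    have hmem : M * h * M⁻¹ ∈ (Matrix.SpecialLinearGroup.map (n := Fin 2) σ).range := by
      apply mem_range_map_of_forall_mem σ.injective
      have hpr : ∀ a b c d e f, M a b * h c d * M e f ∈ σ.range := by
        intro a b c d e f
        obtain ⟨y, hy⟩ := mem_integerRing.1 (mem_hilbertModularGroup.1 hh c d)
        refine ⟨q * P a b * y * P e f, ?_⟩
        rw [hP, hP, ← hy]
        simp only [map_mul]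
        linear_combination -(σ (P a b) * σ y * σ (P e f)) * Real.mul_self_sqrt h0.le
      intro i j
      rw [sl_mul_apply, sl_mul_apply, sl_mul_apply]
      obtain ⟨h1, h2, h3, h4⟩ := sl_inv_apply M
      fin_cases j
      · simp only [Fin.zero_eta, h1, h3, add_mul, mul_neg, neg_add]
        exact add_mem (add_mem (hpr _ _ _ _ _ _) (hpr _ _ _ _ _ _))
          (add_mem (neg_mem (hpr _ _ _ _ _ _)) (neg_mem (hpr _ _ _ _ _ _)))
      · simp only [Fin.mk_one, h2, h4, add_mul, mul_neg, neg_add]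
        exact add_mem (add_mem (neg_mem (hpr _ _ _ _ _ _)) (neg_mem (hpr _ _ _ _ _ _)))
          (add_mem (hpr _ _ _ _ _ _) (hpr _ _ _ _ _ _))
    obtain ⟨N, hN⟩ := hmem
    have hNmem : N ∈ integralSL K := by
      rw [← heq, Subgroup.mem_comap, hN]
      exact mul_mem (mul_mem hM (hH hh)) (inv_mem hM)
    obtain ⟨L, rfl⟩ := hNmem
    exact ⟨L, hN⟩
  intro M hM
  refine ⟨?_, hsub hM⟩
  rw [normalizerGroup_eq, SetLike.mem_coe, Subgroup.mem_normalizer_iff]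
  intro h
  refine ⟨hconj M hM h, fun hh => ?_⟩
  have := hconj M⁻¹ (inv_mem hM) _ hh
  simpa [mul_assoc] using this

theorem isGreatest_normalizerInter (hK : Module.finrank ℚ K = 2) {σ σ' : K →+* ℝ}
    (hσ : σ ≠ σ') {m : ℕ} (hm1 : 1 < m) (hm : Squarefree m) {s : K} (hs : s ^ 2 = (m : K)) :
    IsGreatest (discontinuousExtensions σ σ') (normalizerInter σ) :=
  ⟨normalizerInter_mem_discontinuousExtensions hK hσ,
    fun _ h => discontinuousExtension_le hK hσ hm1 hm hs h⟩

theorem hurwitzMaassExtension_eq (hK : Module.finrank ℚ K = 2) {σ σ' : K →+* ℝ}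
    (hσ : σ ≠ σ') {m : ℕ} (hm1 : 1 < m) (hm : Squarefree m) {s : K} (hs : s ^ 2 = (m : K)) :
    hurwitzMaassExtension σ σ' = normalizerInter σ :=
  (isGreatest_normalizerInter hK hσ hm1 hm hs).isLUB.sSup_eq

end Maximality

/-! ### The second coset and the explicit matrices M₀ -/

section Cosets

variable {K : Type*} [Field K] [NumberField K]

/-- A negative conjugate of δ₀ keeps M₀ out of Σ_K. If M also has negative norm, M₀⁻¹M has square
class δ₀δ of norm (r₀r)², which lies in Σ_K. -/
theorem normalizerIsUnionWith_of_neg (hK : Module.finrank ℚ K = 2) {σ σ' : K →+* ℝ}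
    (hσ : σ ≠ σ') {m : ℕ} (hm1 : 1 < m) (hm : Squarefree m) {s : K} (hs : s ^ 2 = (m : K))
    {M₀ : SL(2, ℝ)} (hM₀ : HasIntegralProducts σ M₀) {δ₀ : K} (hδ₀ : HasSquareClass σ M₀ δ₀)
    (hneg : σ' δ₀ < 0) : NormalizerIsUnionWith σ σ' (M₀ : Matrix (Fin 2) (Fin 2) ℝ) := by
  have heq := hurwitzMaassExtension_eq hK hσ hm1 hm hs
  have hnorm₀ : M₀ ∈ normalizerGroup σ := mem_normalizerGroup_iff.2 hM₀
  have hsub : ∀ M N : SL(2, ℝ), M ∈ normalizerGroup σ → N ∈ normalizerGroup σ →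
      M * N ∈ normalizerGroup σ ∧ M⁻¹ ∈ normalizerGroup σ := by
    intro M N hM hN
    rw [normalizerGroup_eq] at *
    exact ⟨mul_mem hM hN, inv_mem hM⟩
  refine ⟨M₀, rfl, ?_, ?_⟩
  · rw [heq]
    intro h
    exact absurd (hδ₀.pos_of_mem_sigmaSet (σ' := σ') h.2) hneg.not_gt
  · rw [heq]
    ext M
    simp only [Set.mem_union, SetLike.mem_coe, Set.mem_smul_set_iff_inv_smul_mem, smul_eq_mul]
    constructor
    · intro hM
      have hMi := mem_normalizerGroup_iff.1 hM
      obtain ⟨δ, hδ⟩ := hMi.exists_hasSquareClass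
      obtain ⟨r, hr, h | h⟩ := hMi.norm_eq_or hK hσ hδ
      · exact Or.inl ⟨hM, hδ.mem_sigmaSet_of_norm_eq_sq hK hσ hr h⟩
      · right
        refine ⟨(hsub _ _ (hsub _ _ hnorm₀ hM).2 hM).1, ?_⟩
        obtain ⟨r₀, hr₀, h₀ | h₀⟩ := hM₀.norm_eq_or hK hσ hδ₀
        · have := mul_neg_of_pos_of_neg hδ₀.1 hneg
          rw [h₀] at this
          exact absurd this (sq_nonneg _).not_gt
        · refine (hδ₀.inv.mul hδ).mem_sigmaSet_of_norm_eq_sq hK hσ (mul_pos hr₀ hr) ?_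
          rw [map_mul, map_mul, mul_mul_mul_comm, h, h₀]
          push_cast
          ring
    · rintro (h | h)
      · exact h.1
      · have := (hsub _ _ hnorm₀ h.1).1
        rwa [mul_inv_cancel_left] at this

/-- Writing L/√u as √u·(L/u) exhibits the square class u, and divisibility by u is the integrality
of the products of entries. -/
theorem normalizerIsUnionWith_of_dvd (hK : Module.finrank ℚ K = 2) {σ σ' : K →+* ℝ}
    (hσ : σ ≠ σ') {m : ℕ} (hm1 : 1 < m) (hm : Squarefree m) {s : K} (hs : s ^ 2 = (m : K))
    {u : 𝓞 K} (hpos : 0 < σ u) (hneg : σ' u < 0) {L : Matrix (Fin 2) (Fin 2) (𝓞 K)}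
    (hdet : L.det = u) (hdvd : ∀ i j k l, u ∣ L i j * L k l) :
    NormalizerIsUnionWith σ σ' ((√(σ u))⁻¹ • embedMatrix σ L) := by
  have hu : (√(σ u))⁻¹ * (√(σ u))⁻¹ = (σ u)⁻¹ := by
    rw [← mul_inv, Real.mul_self_sqrt hpos.le]
  have hdet' : ((√(σ u))⁻¹ • embedMatrix σ L).det = 1 := by
    have h := congrArg (fun x : 𝓞 K => σ x) hdet
    simp only [Matrix.det_fin_two, map_sub, map_mul] at h
    simp only [Matrix.det_fin_two, embedMatrix, Matrix.smul_apply, Matrix.map_apply, smul_eq_mul]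
    have h2 : (σ u)⁻¹ * σ u = 1 := inv_mul_cancel₀ hpos.ne'
    rw [← hu, ← h] at h2
    rw [← h2]
    ring_nf
    rw [h]
    ring
  refine normalizerIsUnionWith_of_neg hK hσ hm1 hm hs (M₀ := ⟨_, hdet'⟩) (δ₀ := u) ?_
    ⟨hpos, Matrix.of fun i j => (L i j : K) / u, ?_⟩ hneg
  · intro i j k l
    obtain ⟨y, hy⟩ := hdvd i j k l
    refine mem_integerRing.2 ⟨y, ?_⟩
    have h := congrArg (fun x : 𝓞 K => σ x) hy
    simp only [map_mul] at h
    change σ y = ((√(σ u))⁻¹ * σ (L i j)) * ((√(σ u))⁻¹ * σ (L k l))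
    rw [mul_mul_mul_comm, hu, h, inv_mul_cancel_left₀ hpos.ne']
  · intro i j
    change (√(σ u))⁻¹ * σ (L i j) = √(σ u) * σ ((L i j : K) / u)
    rw [map_div₀]
    have := Real.sqrt_pos.2 hpos
    field_simp
    rw [Real.sq_sqrt hpos.le, mul_comm]

theorem normalizerGroup_eq_of_forall (hK : Module.finrank ℚ K = 2) {σ σ' : K →+* ℝ}
    (hσ : σ ≠ σ') {m : ℕ} (hm1 : 1 < m) (hm : Squarefree m) {s : K} (hs : s ^ 2 = (m : K))
    {q : ℕ} (hq : q.Prime) (hq3 : q % 4 = 3) (hqm : q ∣ m) :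
    normalizerGroup σ = (hurwitzMaassExtension σ σ' : Set SL(2, ℝ)) := by
  rw [hurwitzMaassExtension_eq hK hσ hm1 hm hs]
  ext M
  refine ⟨fun hM => ⟨hM, ?_⟩, fun hM => hM.1⟩
  have hMi := mem_normalizerGroup_iff.1 hM
  obtain ⟨δ, hδ⟩ := hMi.exists_hasSquareClass
  obtain ⟨r, hr, h | h⟩ := hMi.norm_eq_or hK hσ hδ
  · exact hδ.mem_sigmaSet_of_norm_eq_sq hK hσ hr h
  · exact absurd hqm (not_dvd_of_norm_eq_neg_sq hK hσ hm1 hm hs hr.ne' h hq hq3)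

theorem exists_isAdmissible {m : ℕ} (hm1 : 1 < m) (hm : Squarefree m)
    (h : ∀ q : ℕ, q.Prime → q % 4 = 3 → ¬ q ∣ m) :
    ∃ (α β : ℕ) (ν μ : ℤ), IsAdmissible m α β ν μ := by
  obtain ⟨x, y, hxy⟩ := Nat.eq_sq_add_sq_iff.2 fun q hq hq3 =>
    absurd (Nat.dvd_of_mem_primeFactors hq) (h q (Nat.prime_of_mem_primeFactors hq) hq3)
  have hcop : ∀ g : ℕ, g ∣ x → g ∣ y → g = 1 := by
    intro g hx hy
    apply Nat.isUnit_iff.1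
    apply hm
    rw [hxy, sq, sq]
    exact dvd_add (mul_dvd_mul hx hx) (mul_dvd_mul hy hy)
  wlog hodd : Odd x generalizing x y
  · have hx : 2 ∣ x := (Nat.not_odd_iff_even.1 hodd).two_dvd
    refine this y x (by rw [hxy, add_comm]) (fun g h1 h2 => hcop g h2 h1) ?_
    by_contra hy
    exact absurd (hcop 2 hx (Nat.not_odd_iff_even.1 hy).two_dvd) (by norm_num)
  have hy0 : 0 < y := by
    rw [Nat.pos_iff_ne_zero]
    rintro rfl
    have := hcop x dvd_rfl (dvd_zero x)
    subst this
    omega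
  -- Squarefreeness of m makes x and y coprime, and x is odd; Bézout for x and 2y yields ν and -μ.
  have hc : Nat.Coprime x (2 * y) := by
    refine Nat.Coprime.mul_right hodd.coprime_two_right ?_
    exact hcop _ (Nat.gcd_dvd_left _ _) (Nat.gcd_dvd_right _ _)
  obtain ⟨a, b, hab⟩ := Nat.isCoprime_iff_coprime.2 hc
  refine ⟨x, y, a, -b, hodd.pos, hy0, hodd, hxy, ?_⟩
  push_cast at hab
  linear_combination hab

theorem normalizerIsUnionWith_of_isAdmissible (hK : Module.finrank ℚ K = 2) {σ σ' : K →+* ℝ}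
    (hσ : σ ≠ σ') {m : ℕ} (hm1 : 1 < m) (hm : Squarefree m) {s : K} (hs : s ^ 2 = (m : K))
    {α β : ℕ} {ν μ : ℤ} (h : IsAdmissible m α β ν μ) :
    NormalizerIsUnionWith σ σ'
      ((√(β + √(m : ℝ)))⁻¹ • matrixL α ν μ (β + √(m : ℝ))) := by
  obtain ⟨hα, hβ, -, hmαβ, hνμ⟩ := h
  wlog hp : 0 ≤ σ s generalizing s
  · exact this (s := -s) (by rw [neg_sq, hs]) (by rw [map_neg]; linarith)
  have hσs : σ s = √(m : ℝ) := by
    rw [eq_comm, Real.sqrt_eq_iff_eq_sq (Nat.cast_nonneg m) hp, ← map_pow, hs, map_natCast]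
  have hσs' := embedding_sqrt_eq_neg hK hσ hm1 hm hs
  have hsi : IsIntegral ℤ s := by
    apply IsIntegral.of_pow (n := 2) (by norm_num)
    rw [hs]
    exact_mod_cast isIntegral_algebraMap (R := ℤ) (A := K) (x := (m : ℤ))
  let t : 𝓞 K := ⟨s, hsi⟩
  have htK : (t : K) = s := rfl
  have ht : t ^ 2 = (α : 𝓞 K) ^ 2 + (β : 𝓞 K) ^ 2 := by
    apply RingOfIntegers.coe_injective
    simp only [map_pow, map_add, map_natCast, htK, hs, hmαβ]
    push_cast
    ring
  have hνμ' : (ν : 𝓞 K) * α - 2 * μ * β = 1 := by 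
    exact_mod_cast congrArg (Int.cast : ℤ → 𝓞 K) hνμ
  let u : 𝓞 K := β + t
  have hu : u = β + t := rfl
  have hσu : σ u = β + √(m : ℝ) := by simp [hu, htK, hσs]
  have hβ' : (0 : ℝ) < β := by exact_mod_cast hβ
  have hlt : (β : ℝ) < √(m : ℝ) := by
    apply Real.lt_sqrt_of_sq_lt
    have : β ^ 2 < m := by rw [hmαβ]; exact Nat.lt_add_of_pos_left (by positivity)
    exact_mod_cast this
  have key := normalizerIsUnionWith_of_dvd hK hσ hm1 hm hs (u := u)
    (L := !![μ * α + ν * u, μ * u; u, (α : 𝓞 K)]) (by rw [hσu]; positivity)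
    (by simp only [hu, map_add, map_natCast, htK, hσs', hσs]; linarith)
    (by
      rw [Matrix.det_fin_two_of]
      linear_combination u * hνμ' - (μ : 𝓞 K) * ht)
    (by
      -- Modulo u every entry is a multiple of α, and α² = m - β² = u(t - β), so u divides all
      -- products.
      have hd : ∀ i j, ∃ c w : 𝓞 K,
          (!![μ * α + ν * u, μ * u; u, (α : 𝓞 K)] : Matrix (Fin 2) (Fin 2) (𝓞 K)) i j =
            c * α + u * w := by
        intro i j
        fin_cases i <;> fin_cases j
        · exact ⟨μ, ν, by simp; ring⟩
        · exact ⟨0, μ, by simp; ring⟩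
        · exact ⟨0, 1, by simp⟩
        · exact ⟨1, 0, by simp⟩
      intro i j k l
      obtain ⟨c, w, h1⟩ := hd i j
      obtain ⟨c', w', h2⟩ := hd k l
      rw [h1, h2]
      refine ⟨c * c' * (t - β) + c * α * w' + c' * α * w + u * w * w', ?_⟩
      rw [hu]
      linear_combination -(c * c') * ht)
  rw [hσu] at key
  convert key using 2
  ext i j
  fin_cases i <;> fin_cases j <;> simp [matrixL, embedMatrix, ← hσu]

theorem normalizerIsUnionWith_of_unit (hK : Module.finrank ℚ K = 2) {σ σ' : K →+* ℝ}
    (hσ : σ ≠ σ') {m : ℕ} (hm1 : 1 < m) (hm : Squarefree m) {s : K} (hs : s ^ 2 = (m : K))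
    {ε : (𝓞 K)ˣ} (hpos : 0 < σ (ε : 𝓞 K)) (hε : σ (ε : 𝓞 K) * σ' (ε : 𝓞 K) = -1) :
    NormalizerIsUnionWith σ σ' ((√(σ (ε : 𝓞 K)))⁻¹ • !![σ (ε : 𝓞 K), 0; 0, 1]) := by
  have key := normalizerIsUnionWith_of_dvd hK hσ hm1 hm hs (u := (ε : 𝓞 K))
    (L := !![(ε : 𝓞 K), 0; 0, 1]) hpos
    (neg_of_mul_neg_right (by rw [hε]; norm_num) hpos.le)
    (by simp) (fun i j k l => ε.isUnit.dvd)
  convert key using 2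
  ext i j
  fin_cases i <;> fin_cases j <;> simp [embedMatrix]

theorem norm_unit (hK : Module.finrank ℚ K = 2) {σ σ' : K →+* ℝ} (hσ : σ ≠ σ') (ε : (𝓞 K)ˣ) :
    σ (ε : 𝓞 K) * σ' (ε : 𝓞 K) = 1 ∨ σ (ε : 𝓞 K) * σ' (ε : 𝓞 K) = -1 := by
  have h := NumberField.isUnit_iff_norm.1 ε.isUnit
  rw [RingOfIntegers.coe_norm] at h
  rw [← norm_eq_mul_embeddings hK hσ]
  rcases (abs_eq zero_le_one).1 h with h | h
  · left; rw [h]; simp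
  · right; rw [h]; simp

end Cosets

end HilbertModular

end

theorem corollary1 {K : Type*} [Field K] [NumberField K] (hK : Module.finrank ℚ K = 2)
    (σ σ' : K →+* ℝ) (hσ : σ ≠ σ')
    (m : ℕ) (hm1 : 1 < m) (hm : Squarefree m)
    (hs : ∃ s : K, s ^ 2 = (m : K))
    (ε : (𝓞 K)ˣ) (hε : HilbertModular.IsFundamentalUnit σ ε) :
    -- the maximal discontinuous extension exists
    IsGreatest (HilbertModular.discontinuousExtensions σ σ')
      (HilbertModular.hurwitzMaassExtension σ σ') ∧
    ((σ (ε : 𝓞 K) * σ' (ε : 𝓞 K) = 1 ∧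
        ∃ p : ℕ, p.Prime ∧ p % 4 = 3 ∧ (p : ℤ) ∣ NumberField.discr K) →
      HilbertModular.normalizerGroup σ =
        (HilbertModular.hurwitzMaassExtension σ σ' : Set SL(2, ℝ))) ∧
    (¬ (σ (ε : 𝓞 K) * σ' (ε : 𝓞 K) = 1 ∧
        ∃ p : ℕ, p.Prime ∧ p % 4 = 3 ∧ (p : ℤ) ∣ NumberField.discr K) →
      -- the first choice of the matrix
      (σ (ε : 𝓞 K) * σ' (ε : 𝓞 K) = -1 →
        HilbertModular.NormalizerIsUnionWith σ σ'
          ((√(σ (ε : 𝓞 K)))⁻¹ • !![σ (ε : 𝓞 K), 0; 0, 1])) ∧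
      -- the second choice is always possible, and each such choice is good
      (∃ (α β : ℕ) (ν μ : ℤ), HilbertModular.IsAdmissible m α β ν μ) ∧
      (∀ (α β : ℕ) (ν μ : ℤ), HilbertModular.IsAdmissible m α β ν μ →
        HilbertModular.NormalizerIsUnionWith σ σ'
          ((√(β + √(m : ℝ)))⁻¹ • HilbertModular.matrixL α ν μ (β + √(m : ℝ))))) := by
  obtain ⟨s, hs⟩ := hs
  have hpos : 0 < σ (ε : 𝓞 K) := one_pos.trans hε.1
  have hodd : ∀ q : ℕ, q % 4 = 3 → q ≠ 2 := by
    rintro q h rfl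
    norm_num at h
  refine ⟨?_, ?_, fun hcase => ⟨fun h => ?_, ?_, fun α β ν μ h => ?_⟩⟩
  · rw [HilbertModular.hurwitzMaassExtension_eq hK hσ hm1 hm hs]
    exact HilbertModular.isGreatest_normalizerInter hK hσ hm1 hm hs
  · rintro ⟨-, q, hq, hq3, hqd⟩
    exact HilbertModular.normalizerGroup_eq_of_forall hK hσ hm1 hm hs hq hq3
      ((HilbertModular.dvd_discr_iff hK hσ hm1 hm hs hq (hodd q hq3)).1 hqd)
  · exact HilbertModular.normalizerIsUnionWith_of_unit hK hσ hm1 hm hs hpos h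
  · apply HilbertModular.exists_isAdmissible hm1 hm
    intro q hq hq3 hqm
    rcases HilbertModular.norm_unit hK hσ ε with h | h
    · exact hcase ⟨h, q, hq, hq3,
        (HilbertModular.dvd_discr_iff hK hσ hm1 hm hs hq (hodd q hq3)).2 hqm⟩
    -- A unit of norm -1 is the case r = 1 of the obstruction.
    · exact HilbertModular.not_dvd_of_norm_eq_neg_sq hK hσ hm1 hm hs (r := 1) one_ne_zero
        (by rw [h]; norm_num) hq hq3 hqm
  · exact HilbertModular.normalizerIsUnionWith_of_isAdmissible hK hσ hm1 hm hs h
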